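/- Consider the $M/M/c$ queue ($c \ge 1$) with two customer classes, class 2 having preemptive-resume priority over class 1, with arrival rates $\lambda_1,\lambda_2>0$ and service rates $\mu_1,\mu_2>0$. Let $X(t)=(X_1(t),X_2(t))$, where $X_n(t)$ is the number of class-$n$ customers in the system; $X$ is the continuous-time Markov chain on $\mathbb{N}_0^2$ whose non-zero transition rates are $q((i,j),(i+1,j))=\lambda_1$, $q((i,j),(i,j+1))=\lambda_2$, $q((i,j),(i-1,j))=\max(\min(i,c-j),0)\,\mu_1$ for $i\ge1$, and $q((i,j),(i,j-1))=\min(c,j)\,\mu_2$ for $j\ge1$. No stability condition is imposed. Write $\mathbb{E}_x$ for expectation given $X(0)=x$, let $L_i=\{(i,0),\dots,(i,c-1)\}$ be lower level $i$, and let $\tau_A=\inf\{t>0:\lim_{s\uparrow t}X(s)\ne X(t)\in A\}$ (with $\inf\emptyset=\infty$ and $\mathrm{e}^{-\alpha\infty}=0$). Let $\alpha\in\mathbb{C}$ with $\operatorname{Re}\alpha>0$. For $x\in\mathbb{N}_0^2$ put $\pi_x(\alpha)=\int_0^\infty \mathrm{e}^{-\alpha t}\,\mathbb{P}(X(t)=x\mid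 X(0)=(0,0))\,dt$, and let $\pi_i(\alpha)=(\pi_{(i,0)}(\alpha),\dots,\pi_{(i,c-1)}(\alpha))$ (a row vector). Define the following $c\times c$ matrices, with rows and columns indexed by $0,\dots,c-1$: - $A_1=\lambda_1 I$; - $W_m(\alpha)$, $m\ge0$, whose only possibly non-zero entry is $(W_m(\alpha))_{c-1,c-1}=\lambda_2\,\mathbb{E}\bigl[\mathrm{e}^{-\alpha B}\mathbf{1}\{\Lambda(B)=m\}\bigr]$, where $B$ is the busy period, started by one customer, of an $M/M/1$ queue with arrival rate $\lambda_2$ and service rate $c\mu_2$, and $\Lambda$ is a Poisson process of rate $\lambda_1$ independent of that queue; - $G_{i,j}(\alpha)$, $i>j\ge0$, with $(G_{i,j}(\alpha))_{k,l}=\mathbb{E}_{(i,k)}\bigl[\mathrm{e}^{-\alpha\tau_{L_j}}\mathbf{1}\{X(\tau_{L_j})=(j,l)\}\bigr]$, and $G_{i,i}(\alpha)=I$; - $N_i(\alpha)$, $i\ge1$, with $(N_i(\alpha))_{k,l}=\mathbb{E}_{(i,k)}\bigl[\int_0^{\tau_{L_{i-1}}}\mathrm{e}^{-\alpha t}\mathbf{1}\{X(t)=(i,l)\}\,dt\bigr]$.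 Then for every integer $i\ge0$, $$\pi_{i+1}(\alpha)=\pi_i(\alpha)A_1N_{i+1}(\alpha)+\sum_{k=0}^{i}\pi_k(\alpha)\sum_{l=i+1}^{\infty}W_{l-k}(\alpha)G_{l,i+1}(\alpha)N_{i+1}(\alpha),$$ where the infinite series of matrices converge absolutely. -/

import Mathlib

open MeasureTheory ProbabilityTheory Filter Topology
open scoped ENNReal NNReal Matrix

noncomputable section

namespace PriorityQueue

/-! ### Continuous-time Markov chains on a countable state space

The off-diagonal transition rates are given by a function `q : S → S → ℝ≥0` (its diagonal is
never used).  The chain started at `x` is constructed from its embedded jump chain and its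
exponential sojourn times. -/

section Rates

variable {S : Type}

open Classical in
/-- The rate of the jumps from `x` to `y ≠ x`, as an extended nonnegative real. -/
def jumpRate (q : S → S → ℝ≥0) (x y : S) : ℝ≥0∞ := if y = x then 0 else (q x y : ℝ≥0∞)

/-- The total rate `q(x) = ∑_{y ≠ x} q(x, y)` at which the state `x` is left. -/
def exitRate (q : S → S → ℝ≥0) (x : S) : ℝ≥0∞ := ∑' y, jumpRate q x y

open Classical in
/-- One step of the embedded jump chain: from `x` the chain jumps to `y ≠ x` with probability
`q(x, y) / q(x)`.  An absorbing state (`q(x) = 0`) is left in place; the case `q(x) = ∞` of an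
instantaneous state is not used. -/
def jumpPMF (q : S → S → ℝ≥0) (x : S) : PMF S :=
  if h : exitRate q x ≠ 0 ∧ exitRate q x ≠ ⊤ then PMF.normalize (jumpRate q x) h.1 h.2
  else PMF.pure x

open Classical in
/-- The parameter of the exponential sojourn times at `x`, namely `q(x)`.  At an absorbing state,
where the embedded chain stays put, any positive value gives the process that is constant. -/
def holdRate (q : S → S → ℝ≥0) (x : S) : ℝ :=
  if exitRate q x ≠ 0 ∧ exitRate q x ≠ ⊤ then (exitRate q x).toReal else 1

lemma holdRate_pos (q : S → S → ℝ≥0) (x : S) : 0 < holdRate q x := by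
  unfold holdRate
  split_ifs with h
  · exact ENNReal.toReal_pos h.1 h.2
  · exact one_pos

end Rates

section MarkovChain

variable {S : Type} [Countable S] [MeasurableSpace S] [MeasurableSingletonClass S]

/-- The embedded jump chain as a Markov kernel. -/
def jumpKernel (q : S → S → ℝ≥0) : Kernel S S :=
  Kernel.ofFunOfCountable fun x => (jumpPMF q x).toMeasure

instance (q : S → S → ℝ≥0) : IsMarkovKernel (jumpKernel q) :=
  ⟨fun x => inferInstanceAs (IsProbabilityMeasure (jumpPMF q x).toMeasure)⟩

/-- The exponential law of the sojourn time, as a Markov kernel. -/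
def holdKernel (q : S → S → ℝ≥0) : Kernel S ℝ :=
  Kernel.ofFunOfCountable fun x => expMeasure (holdRate q x)

instance (q : S → S → ℝ≥0) : IsMarkovKernel (holdKernel q) :=
  ⟨fun x => isProbabilityMeasure_expMeasure (holdRate_pos q x)⟩

/-- From the current state of the embedded chain: the next state, together with the sojourn time
in that next state. -/
def stepKernel (q : S → S → ℝ≥0) : Kernel S (S × ℝ) :=
  Kernel.ofFunOfCountable fun x => jumpKernel q x ⊗ₘ holdKernel q

instance (q : S → S → ℝ≥0) : IsMarkovKernel (stepKernel q) :=
  ⟨fun x => inferInstanceAs (IsProbabilityMeasure (jumpKernel q x ⊗ₘ holdKernel q))⟩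

/-- The same transition mechanism, given the whole history up to step `n`, of which it only uses
the last state. -/
def historyKernel (q : S → S → ℝ≥0) (n : ℕ) :
    Kernel (Π _ : Finset.Iic n, S × ℝ) (S × ℝ) :=
  (stepKernel q).comap (fun h => (h ⟨n, Finset.mem_Iic.2 le_rfl⟩).1)
    (measurable_fst.comp (measurable_pi_apply _))

instance (q : S → S → ℝ≥0) (n : ℕ) : IsMarkovKernel (historyKernel q n) :=
  inferInstanceAs (IsMarkovKernel ((stepKernel q).comap _ _))

/-- The probability measure `P_x`: the law of the sequence of pairs (visited state, sojourn time)
of the Markov chain with rates `q` that starts at `x`. -/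
def chainLaw (q : S → S → ℝ≥0) (x : S) : Measure (ℕ → S × ℝ) :=
  Kernel.trajMeasure (X := fun _ => S × ℝ) (Measure.dirac x ⊗ₘ holdKernel q) (historyKernel q)

instance (q : S → S → ℝ≥0) (x : S) : IsProbabilityMeasure (chainLaw q x) :=
  inferInstanceAs (IsProbabilityMeasure (Kernel.trajMeasure (X := fun _ => S × ℝ) _ _))

end MarkovChain

section Paths

variable {S : Type}

/-- The time of the `n`-th jump (`0` for `n = 0`). -/
def jumpTime (ω : ℕ → S × ℝ) (n : ℕ) : ℝ := ∑ k ∈ Finset.range n, (ω k).2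

/-- The state at time `t`: the `n`-th visited state for the first `n` whose sojourn ends after `t`.
(For chains with bounded rates, such as all those below, there almost surely is such an `n` for
every `t`.) -/
def path (ω : ℕ → S × ℝ) (t : ℝ) : S := (ω (sInf {n : ℕ | t < jumpTime ω (n + 1)})).1

/-- The first time at which the path `X` makes a transition into `A`:
`τ_A = inf {t > 0 : lim_{s ↑ t} X(s) ≠ X(t) ∈ A}`, with `inf ∅ = ∞`. -/
def hitTime (X : ℝ → S) (A : Set S) : ℝ≥0∞ :=
  ⨅ t ∈ {t : ℝ | 0 < t ∧ ∃ y, (∀ᶠ s in 𝓝[<] t, X s = y) ∧ y ≠ X t ∧ X t ∈ A}, ENNReal.ofReal t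

end Paths

/-- `exp (-α τ)`, which is `0` for `τ = ∞` (used for `Re α > 0`). -/
def discount (α : ℂ) (τ : ℝ≥0∞) : ℂ := if τ = ⊤ then 0 else Complex.exp (-α * (τ.toReal : ℂ))

/-! ### The single-server queue and the Poisson process -/

/-- The rates of the number of customers in an `M/M/1` queue with arrival rate `lam` and service
rate `mu`. -/
def mm1Rate (lam mu : ℝ≥0) (n m : ℕ) : ℝ≥0 :=
  if m = n + 1 then lam else if m + 1 = n then mu else 0

/-- The rates of the counting process of a homogeneous Poisson process of rate `th`. -/
def poissonRate (th : ℝ≥0) (n m : ℕ) : ℝ≥0 := if m = n + 1 then th else 0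

open Classical in
/-- `E_1[exp (-α B) 1{Λ(B) = i}]`, where `B` is the busy period of an `M/M/1` queue that starts with
one customer (the time until it is empty), and `Λ` is a Poisson process of rate `th` that is
independent of the queue. -/
def busyPoisson (lam mu th : ℝ≥0) (i : ℕ) (α : ℂ) : ℂ :=
  ∫ ω : (ℕ → ℕ × ℝ) × (ℕ → ℕ × ℝ),
    discount α (hitTime (path ω.1) {0}) *
      (if path ω.2 (hitTime (path ω.1) {0}).toReal = i then 1 else 0)
    ∂((chainLaw (mm1Rate lam mu) 1).prod (chainLaw (poissonRate th) 0))

/-! ### The two-class preemptive priority queue -/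

/-- The data of the `M/M/c` queue with two classes, class 2 having preemptive priority: number of
servers, arrival rates, service rates. -/
structure Params where
  c : ℕ
  lam₁ : ℝ≥0
  lam₂ : ℝ≥0
  mu₁ : ℝ≥0
  mu₂ : ℝ≥0

namespace Params

variable (M : Params)

/-- The transition rates of `X = (X₁, X₂)`, the numbers of customers of the two classes.  Since
subtraction of natural numbers is truncated, `min i (c - j)` is `max (min (i, c - j), 0)`. -/
def rate (x y : ℕ × ℕ) : ℝ≥0 :=
  if y = (x.1 + 1, x.2) then M.lam₁
  else if y = (x.1, x.2 + 1) then M.lam₂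
  else if (y.1 + 1, y.2) = x then ((min x.1 (M.c - x.2) : ℕ) : ℝ≥0) * M.mu₁
  else if (y.1, y.2 + 1) = x then ((min M.c x.2 : ℕ) : ℝ≥0) * M.mu₂
  else 0

/-- The law `P_x` of the queue that starts in the state `x`. -/
def law (x : ℕ × ℕ) : Measure (ℕ → (ℕ × ℕ) × ℝ) := chainLaw M.rate x

/-- The transition function `p_x(t) = P(X(t) = x | X(0) = (0, 0))`. -/
def transition (x : ℕ × ℕ) (t : ℝ) : ℝ := (M.law (0, 0)).real {ω | path ω t = x}

/-- Its Laplace transform `π_x(α)`. -/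
def laplace (x : ℕ × ℕ) (α : ℂ) : ℂ :=
  ∫ t in Set.Ici (0 : ℝ), Complex.exp (-α * (t : ℂ)) * (M.transition x t : ℂ)

/-- Lower level `i`, the set `{(i, 0), …, (i, c - 1)}`. -/
def lowerLevel (i : ℕ) : Set (ℕ × ℕ) := {x | x.1 = i ∧ x.2 < M.c}

/-- The row vector `π_i(α) = (π_(i,0)(α), …, π_(i,c-1)(α))`. -/
def piVec (i : ℕ) (α : ℂ) : Fin M.c → ℂ := fun j => M.laplace (i, j) α

/-- `A₁ = λ₁ I`. -/
def A₁ : Matrix (Fin M.c) (Fin M.c) ℂ := ((M.lam₁ : ℝ) : ℂ) • (1 : Matrix (Fin M.c) (Fin M.c) ℂ)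

/-- `W_m(α)`, whose only nonzero entry is the one in the last row and column. -/
def W (m : ℕ) (α : ℂ) : Matrix (Fin M.c) (Fin M.c) ℂ := fun k l =>
  if (k : ℕ) + 1 = M.c ∧ (l : ℕ) + 1 = M.c then
    ((M.lam₂ : ℝ) : ℂ) * busyPoisson M.lam₂ ((M.c : ℝ≥0) * M.mu₂) M.lam₁ m α
  else 0

open Classical in
/-- `G_{i,j}(α)`, with entries `E_(i,k)[exp (-α τ) 1{X(τ) = (j, l)}]`, where `τ` is the first time
of a transition into lower level `j`; for `i = j` the identity matrix, by convention.  (Used for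
`i ≥ j`.) -/
def G (i j : ℕ) (α : ℂ) : Matrix (Fin M.c) (Fin M.c) ℂ :=
  if i = j then 1
  else fun k l =>
    ∫ ω, discount α (hitTime (path ω) (M.lowerLevel j)) *
        (if path ω (hitTime (path ω) (M.lowerLevel j)).toReal = (j, (l : ℕ)) then 1 else 0)
      ∂(M.law (i, k))

open Classical in
/-- `N_i(α)` for `i ≥ 1`, with entries `E_(i,k)[∫_0^τ exp (-α t) 1{X(t) = (i, l)} dt]`, where `τ` is
the first time of a transition into lower level `i - 1`. -/
def N (i : ℕ) (α : ℂ) : Matrix (Fin M.c) (Fin M.c) ℂ := fun k l =>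
  ∫ ω, (∫ t in {t : ℝ | 0 ≤ t ∧ ENNReal.ofReal t < hitTime (path ω) (M.lowerLevel (i - 1))},
      Complex.exp (-α * (t : ℂ)) * (if path ω t = (i, (l : ℕ)) then 1 else 0))
    ∂(M.law (i, k))

end Params

end PriorityQueue

end

noncomputable section

namespace PriorityQueue

/-! ### The Markov property at the first jump -/

/-! The recursion is a last-exit decomposition, carried out with resolvent equations instead of
stopping times. Fix a target state `(i + 1, l)` with `l < c`, and let `B` be the finite set of lower
states of levels at most `i`. Let `v` (`excMean`) be the discounted mean time spent in the target
before `B` is visited, with `v = 0` on `B`. Off `B`, `v` satisfies the resolvent equation with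
source the indicator of the target. On `B` it misses that equation exactly by `gen v`. Hence `v`
equals the resolvent of the target minus the sum over `y ∈ B` of `gen v y` times the resolvent of
`y`. At `(0, 0) ∈ B` this expresses the Laplace transform of the target through those of the states
in `B` (`resolvent_eq_sum`).

Only two kinds of jumps leave `B` (`gen_excMean`). A class-1 arrival at level `i` leads to `(i + 1,
j)` and gives the term with `A₁ N`. A class-2 arrival at `(k, c - 1)` starts a period in which class
2 holds all servers. During it class 2 is an `M/M/1` queue and class 1 an independent Poisson
process, so the lower states are next reached at `(k + m, c - 1)` with the discounted weight
contained in `W m`. If `k + m ≤ i`, nothing is collected. Otherwise, since levels fall one at a time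
and only from lower states, level `i` is reached through lower level `i + 1`, which gives the factor
`G N` (`levelMean_eq_sum`).

Two tools support this. The law of the chain is that of an exponential time followed by a fresh
chain from the next state (`chainLaw_eq_consLaw`), so every functional solves a first-step equation
(`BoundedRates.meanTotal_eq`). The rates are bounded, so bounded solutions are unique
(`eq_zero_of_gen`). Each identity that is probabilistically a strong Markov property follows by
checking that its two sides solve the same equation. -/

/-- The sequence `a, ω 0, ω 1, …`. -/
def consSeq {β : Type} (a : β) (ω : ℕ → β) : ℕ → β
  | 0 => a
  | n + 1 => ω n

@[simp] lemma consSeq_zero {β : Type} (a : β) (ω : ℕ → β) : consSeq a ω 0 = a := rfl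
@[simp] lemma consSeq_succ {β : Type} (a : β) (ω : ℕ → β) (n : ℕ) :
    consSeq a ω (n + 1) = ω n := rfl

lemma measurable_consSeq {β : Type} [MeasurableSpace β] :
    Measurable fun p : β × (ℕ → β) => consSeq p.1 p.2 := by
  refine measurable_pi_iff.2 fun n => ?_
  cases n with
  | zero => exact measurable_fst
  | succ n => exact (measurable_pi_apply n).comp measurable_snd

lemma measurable_consSeq_pair {S : Type} [MeasurableSpace S] (x : S) :
    Measurable fun p : ℝ × (ℕ → S × ℝ) => consSeq (x, p.1) p.2 :=
  measurable_consSeq.comp (f := fun p : ℝ × (ℕ → S × ℝ) => (((x, p.1) : S × ℝ), p.2)) (by fun_prop)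

section

variable {S : Type} [Countable S] [MeasurableSpace S] [MeasurableSingletonClass S]

lemma chainLaw_map_zero (q : S → S → ℝ≥0) (x : S) :
    (chainLaw q x).map (fun ω => ω 0) = Measure.dirac x ⊗ₘ holdKernel q := by
  have h : (chainLaw q x).map (Preorder.frestrictLe 0) =
      (Measure.dirac x ⊗ₘ holdKernel q).map
        (MeasurableEquiv.piUnique (fun _ : Finset.Iic 0 => S × ℝ)).symm := by
    rw [chainLaw, Kernel.trajMeasure, Measure.map_comp _ _ (by fun_prop),
      Kernel.traj_map_frestrictLe, Kernel.partialTraj_self, Measure.id_comp]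
  have h2 : (fun ω : ℕ → S × ℝ => ω 0) =
      (MeasurableEquiv.piUnique (fun _ : Finset.Iic 0 => S × ℝ)) ∘ Preorder.frestrictLe 0 := rfl
  rw [h2, ← Measure.map_map (MeasurableEquiv.measurable _) (by fun_prop), h,
    Measure.map_map (MeasurableEquiv.measurable _) (MeasurableEquiv.measurable _),
    MeasurableEquiv.self_comp_symm, Measure.map_id]

/-- This disintegration of the trajectory measure, together with the law of entry 0, determines all
finite-dimensional marginals. It is the property that `consLaw` has to share. -/
lemma chainLaw_lintegral_succ (q : S → S → ℝ≥0) (x : S) (n : ℕ)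
    {f : (Π _ : Finset.Iic n, S × ℝ) × (S × ℝ) → ℝ≥0∞} (hf : Measurable f) :
    ∫⁻ ω, f (Preorder.frestrictLe n ω, ω (n + 1)) ∂chainLaw q x =
      ∫⁻ ω, ∫⁻ z, f (Preorder.frestrictLe n ω, z) ∂stepKernel q (ω n).1 ∂chainLaw q x := by
  have h := Kernel.map_frestrictLe_trajMeasure_compProd_eq_map_trajMeasure
    (X := fun _ => S × ℝ) (μ₀ := Measure.dirac x ⊗ₘ holdKernel q) (κ := historyKernel q) (a := n)
  have h1 := congrArg (fun μ => ∫⁻ p, f p ∂μ) h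
  rw [lintegral_map hf (by fun_prop), Measure.lintegral_compProd hf,
    lintegral_map (Measurable.lintegral_kernel_prod_right' hf) (by fun_prop)] at h1
  exact h1.symm

/-- The law of the sequence from its second entry on. -/
def nextLaw (q : S → S → ℝ≥0) (x : S) : Measure (ℕ → S × ℝ) :=
  (jumpKernel q x).bind (chainLaw q)

lemma measurable_chainLaw (q : S → S → ℝ≥0) : Measurable (chainLaw q) :=
  measurable_of_countable _

instance (q : S → S → ℝ≥0) (x : S) : IsProbabilityMeasure (nextLaw q x) :=
  isProbabilityMeasure_bind (measurable_chainLaw q).aemeasurable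
    (Eventually.of_forall fun _ => inferInstance)

/-- The law of the sequence, after conditioning on its second visited state. -/
def consLaw (q : S → S → ℝ≥0) (x : S) : Measure (ℕ → S × ℝ) :=
  ((expMeasure (holdRate q x)).prod (nextLaw q x)).map fun p => consSeq (x, p.1) p.2

instance (q : S → S → ℝ≥0) (x : S) : IsProbabilityMeasure (expMeasure (holdRate q x)) :=
  isProbabilityMeasure_expMeasure (holdRate_pos q x)


instance (q : S → S → ℝ≥0) (x : S) : IsProbabilityMeasure (consLaw q x) :=
  Measure.isProbabilityMeasure_map (measurable_consSeq_pair x).aemeasurable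

lemma lintegral_consLaw (q : S → S → ℝ≥0) (x : S) {f : (ℕ → S × ℝ) → ℝ≥0∞} (hf : Measurable f) :
    ∫⁻ ω, f ω ∂consLaw q x =
      ∫⁻ s, ∫⁻ y, ∫⁻ ω, f (consSeq (x, s) ω) ∂chainLaw q y ∂jumpKernel q x
        ∂expMeasure (holdRate q x) := by
  have hm := measurable_consSeq_pair x
  rw [consLaw, lintegral_map hf hm,
    lintegral_prod (fun p => f (consSeq (x, p.1) p.2)) (hf.comp hm).aemeasurable]
  refine lintegral_congr fun s => ?_
  rw [nextLaw, Measure.lintegral_bind (measurable_chainLaw q).aemeasurable]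
  exact (hf.comp (hm.comp measurable_prodMk_left)).aemeasurable

lemma lintegral_chainLaw_zero (q : S → S → ℝ≥0) (x : S) {f : S × ℝ → ℝ≥0∞} (hf : Measurable f) :
    ∫⁻ ω, f (ω 0) ∂chainLaw q x = ∫⁻ s, f (x, s) ∂holdKernel q x := by
  rw [← lintegral_map (f := f) (g := fun ω : ℕ → S × ℝ => ω 0) hf (by fun_prop), chainLaw_map_zero,
    Measure.lintegral_compProd hf, lintegral_dirac]

/-- At `n = 0` the second entry is drawn from the initial law of the fresh chain, which is one step
of the jump mechanism from `x`. For later entries this is the disintegration of the fresh chain,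
shifted by one index. -/
lemma consLaw_lintegral_succ (q : S → S → ℝ≥0) (x : S) (n : ℕ)
    {f : (Π _ : Finset.Iic n, S × ℝ) × (S × ℝ) → ℝ≥0∞} (hf : Measurable f) :
    ∫⁻ ω, f (Preorder.frestrictLe n ω, ω (n + 1)) ∂consLaw q x =
      ∫⁻ ω, ∫⁻ z, f (Preorder.frestrictLe n ω, z) ∂stepKernel q (ω n).1 ∂consLaw q x := by
  rw [lintegral_consLaw q x (f := fun ω => f (Preorder.frestrictLe n ω, ω (n + 1))) (by fun_prop),
    lintegral_consLaw q x
      (f := fun ω => ∫⁻ z, f (Preorder.frestrictLe n ω, z) ∂stepKernel q (ω n).1)]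
  · refine lintegral_congr fun s => ?_
    cases n with
    | zero =>
      have h0 : ∀ ω : ℕ → S × ℝ,
          (Preorder.frestrictLe 0 (consSeq (x, s) ω) : Π _ : Finset.Iic 0, S × ℝ) =
            fun _ => (x, s) := by
        intro ω
        funext i
        obtain ⟨i, hi⟩ := i
        have : i = 0 := by simpa using hi
        subst this
        rfl
      simp only [h0, consSeq_zero, zero_add, lintegral_const, measure_univ, mul_one]
      have h1 : ∀ ω : ℕ → S × ℝ, consSeq (x, s) ω 1 = ω 0 := fun _ => rfl
      simp only [h1]
      have : ∀ y, ∫⁻ ω, f (fun _ => (x, s), ω 0) ∂chainLaw q y =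
          ∫⁻ t, f (fun _ => (x, s), (y, t)) ∂holdKernel q y := fun y =>
        lintegral_chainLaw_zero q y (f := fun z => f (fun _ => (x, s), z)) (by fun_prop)
      simp only [this]
      have h2 : stepKernel q x = jumpKernel q x ⊗ₘ holdKernel q := rfl
      rw [h2, Measure.lintegral_compProd (f := fun z => f (fun _ => (x, s), z)) (by fun_prop)]
    | succ n =>
      refine lintegral_congr fun y => ?_
      -- `g` prepends `(x, s)` to a history, so that the recursion of the fresh chain at index `n`
      -- becomes the one at index `n + 1`.
      let g : (Π _ : Finset.Iic n, S × ℝ) → (Π _ : Finset.Iic (n + 1), S × ℝ) := fun u i =>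
        if h : (i : ℕ) = 0 then (x, s)
        else u ⟨(i : ℕ) - 1, Finset.mem_Iic.2 (by have := Finset.mem_Iic.1 i.2; omega)⟩
      have hg : Measurable g := by
        refine measurable_pi_iff.2 fun i => ?_
        by_cases h : (i : ℕ) = 0
        · simp only [g, h, dite_true]; exact measurable_const
        · simp only [g, h, dite_false]; exact measurable_pi_apply _
      have h0 : ∀ ω : ℕ → S × ℝ,
          (Preorder.frestrictLe (n + 1) (consSeq (x, s) ω) : Π _ : Finset.Iic (n + 1), S × ℝ) =
            g (Preorder.frestrictLe n ω) := by
        intro ω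
        funext i
        obtain ⟨i, hi⟩ := i
        cases i with
        | zero => rfl
        | succ i => rfl
      simp only [h0, consSeq_succ]
      exact chainLaw_lintegral_succ q y n (f := fun p => f (g p.1, p.2)) (by fun_prop)
  · have h2 : Measurable fun p : (ℕ → S × ℝ) × (S × ℝ) => f (Preorder.frestrictLe n p.1, p.2) := by
      fun_prop
    exact Measurable.lintegral_kernel_prod_right'
      (κ := (stepKernel q).comap (fun ω : ℕ → S × ℝ => (ω n).1) (by fun_prop)) h2

lemma consLaw_map_frestrictLe (q : S → S → ℝ≥0) (x : S) (n : ℕ) :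
    (consLaw q x).map (Preorder.frestrictLe n) = (chainLaw q x).map (Preorder.frestrictLe n) := by
  induction n with
  | zero =>
    have h2 : (Preorder.frestrictLe 0 : (ℕ → S × ℝ) → (Π _ : Finset.Iic 0, S × ℝ)) =
      (fun z _ => z) ∘ fun ω : ℕ → S × ℝ => ω 0 := by
      funext ω i
      obtain ⟨i, hi⟩ := i
      have : i = 0 := by simpa using hi
      subst this
      rfl
    rw [h2, ← Measure.map_map (by fun_prop) (by fun_prop),
      ← Measure.map_map (by fun_prop) (by fun_prop)]
    congr 1
    refine Measure.ext_of_lintegral _ fun f hf => ?_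
    rw [lintegral_map hf (by fun_prop), lintegral_map hf (by fun_prop),
      lintegral_chainLaw_zero q x hf, lintegral_consLaw q x (f := fun ω => f (ω 0)) (by fun_prop)]
    simp only [consSeq_zero, lintegral_const, measure_univ, mul_one]
    rfl
  | succ n ih =>
    let e : (Π _ : Finset.Iic n, S × ℝ) × (S × ℝ) → (Π _ : Finset.Iic (n + 1), S × ℝ) := fun p i =>
      if h : (i : ℕ) ≤ n then p.1 ⟨i, Finset.mem_Iic.2 h⟩ else p.2
    have he : Measurable e := by
      refine measurable_pi_iff.2 fun i => ?_
      by_cases h : (i : ℕ) ≤ n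
      · simp only [e, h, dite_true]; fun_prop
      · simp only [e, h, dite_false]; fun_prop
    have h2 : (Preorder.frestrictLe (n + 1) : (ℕ → S × ℝ) → (Π _ : Finset.Iic (n + 1), S × ℝ)) =
        fun ω => e (Preorder.frestrictLe n ω, ω (n + 1)) := by
      funext ω i
      obtain ⟨i, hi⟩ := i
      by_cases h : i ≤ n
      · simp [e, h]
      · have : i = n + 1 := by have := Finset.mem_Iic.1 hi; omega
        subst this
        simp [e]
    refine Measure.ext_of_lintegral _ fun f hf => ?_
    rw [lintegral_map hf (by fun_prop), lintegral_map hf (by fun_prop), h2,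
      consLaw_lintegral_succ q x n (f := fun p => f (e p)) (by fun_prop),
      chainLaw_lintegral_succ q x n (f := fun p => f (e p)) (by fun_prop)]
    -- The inner integral depends on the history up to `n` alone, so the induction hypothesis
    -- carries it from one law to the other.
    let F : (Π _ : Finset.Iic n, S × ℝ) → ℝ≥0∞ := fun u =>
      ∫⁻ z, f (e (u, z)) ∂stepKernel q (u ⟨n, Finset.mem_Iic.2 le_rfl⟩).1
    have hF : Measurable F := by
      have h3 : Measurable fun p : (Π _ : Finset.Iic n, S × ℝ) × (S × ℝ) => f (e p) := by fun_prop
      exact Measurable.lintegral_kernel_prod_right' (κ := historyKernel q n) h3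
    have h4 := congrArg (fun μ => ∫⁻ u, F u ∂μ) ih
    rw [lintegral_map hF (by fun_prop), lintegral_map hF (by fun_prop)] at h4
    exact h4

/-- Both measures are projective limits of the same family of marginals, hence equal. This is the
Markov property at the first jump, the only form of it proved directly. -/
theorem chainLaw_eq_consLaw (q : S → S → ℝ≥0) (x : S) : chainLaw q x = consLaw q x := by
  have h1 : IsProjectiveLimit (chainLaw q x) (fun I => (chainLaw q x).map I.restrict) := fun _ => rfl
  have h2 : IsProjectiveLimit (consLaw q x) (fun I => (chainLaw q x).map I.restrict) := by
    refine (isProjectiveLimit_nat_iff' (X := fun _ => S × ℝ) ?_ _ 0).2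
      fun n _ => consLaw_map_frestrictLe q x n
    intro I J hJI
    rw [Measure.map_map (Finset.measurable_restrict₂ _) (Finset.measurable_restrict _)]
    rfl
  exact h1.unique h2

end

/-! ### Step-function paths -/

section Regular

variable {S : Type}

/-- Positive sojourn times, no explosion, and no jump from a state to itself. -/
structure Regular (ω : ℕ → S × ℝ) : Prop where
  pos : ∀ k, 0 < (ω k).2
  tendsto : Tendsto (jumpTime ω) atTop atTop
  ne : ∀ k, (ω (k + 1)).1 ≠ (ω k).1

lemma jumpTime_zero (ω : ℕ → S × ℝ) : jumpTime ω 0 = 0 := by simp [jumpTime]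

lemma jumpTime_succ (ω : ℕ → S × ℝ) (n : ℕ) : jumpTime ω (n + 1) = jumpTime ω n + (ω n).2 := by
  simp [jumpTime, Finset.sum_range_succ]

lemma jumpTime_consSeq (a : S × ℝ) (ω : ℕ → S × ℝ) (n : ℕ) :
    jumpTime (consSeq a ω) (n + 1) = a.2 + jumpTime ω n := by
  simp [jumpTime, Finset.sum_range_succ', add_comm]

lemma Regular.strictMono {ω : ℕ → S × ℝ} (h : Regular ω) : StrictMono (jumpTime ω) :=
  strictMono_nat_of_lt_succ fun n => by rw [jumpTime_succ]; linarith [h.pos n]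

lemma Regular.jumpTime_nonneg {ω : ℕ → S × ℝ} (h : Regular ω) (n : ℕ) : 0 ≤ jumpTime ω n := by
  rw [← jumpTime_zero ω]; exact h.strictMono.monotone n.zero_le

lemma Regular.path_eq {ω : ℕ → S × ℝ} (h : Regular ω) {n : ℕ} {t : ℝ} (h1 : jumpTime ω n ≤ t)
    (h2 : t < jumpTime ω (n + 1)) : path ω t = (ω n).1 := by
  have : sInf {k : ℕ | t < jumpTime ω (k + 1)} = n := by
    refine le_antisymm (Nat.sInf_le h2) ?_
    by_contra! hlt
    have hm : t < jumpTime ω (sInf {k : ℕ | t < jumpTime ω (k + 1)} + 1) :=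
      Nat.sInf_mem (s := {k : ℕ | t < jumpTime ω (k + 1)}) ⟨n, h2⟩
    have := h.strictMono.monotone (Nat.succ_le_of_lt hlt)
    simp only [Nat.succ_eq_add_one] at this
    linarith
  rw [path, this]

lemma Regular.exists_jumpTime {ω : ℕ → S × ℝ} (h : Regular ω) {t : ℝ} (ht : 0 ≤ t) :
    ∃ n, jumpTime ω n ≤ t ∧ t < jumpTime ω (n + 1) := by
  have hex : ∃ k, t < jumpTime ω k := (h.tendsto.eventually_gt_atTop t).exists
  classical
  have h1 := Nat.find_spec hex
  obtain ⟨n, hn⟩ : ∃ n, Nat.find hex = n + 1 := by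
    refine Nat.exists_eq_succ_of_ne_zero fun h0 => ?_
    rw [h0, jumpTime_zero] at h1
    linarith
  refine ⟨n, ?_, hn ▸ h1⟩
  have := Nat.find_min hex (m := n) (by omega)
  linarith

open Classical in
/-- The first positive jump time at which the state belongs to `A`. -/
def jumpHit (A : Set S) (ω : ℕ → S × ℝ) : ℝ≥0∞ :=
  ⨅ n, if (ω (n + 1)).1 ∈ A then ENNReal.ofReal (jumpTime ω (n + 1)) else ⊤

/-- A regular path is constant between consecutive jump times and changes at every positive one, so
its transitions into `A` are exactly the jumps that land in `A`. A countable infimum replaces an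
uncountable one, which makes the hitting time measurable. -/
lemma Regular.hitTime_eq {ω : ℕ → S × ℝ} (h : Regular ω) (A : Set S) :
    hitTime (path ω) A = jumpHit A ω := by
  apply le_antisymm
  · refine le_iInf fun n => ?_
    split_ifs with hA
    · have hp : path ω (jumpTime ω (n + 1)) = (ω (n + 1)).1 :=
        h.path_eq le_rfl (h.strictMono (Nat.lt_succ_self _))
      refine iInf₂_le (jumpTime ω (n + 1)) ⟨?_, (ω n).1, ?_, ?_, ?_⟩
      · rw [← jumpTime_zero ω]; exact h.strictMono n.succ_pos
      · filter_upwards [Ioo_mem_nhdsLT (h.strictMono (Nat.lt_succ_self n))] with s hs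
        exact h.path_eq hs.1.le hs.2
      · rw [hp]; exact (h.ne n).symm
      · rw [hp]; exact hA
    · exact le_top
  · refine le_iInf₂ fun t ht => ?_
    obtain ⟨ht0, y, hy, hne, hA⟩ := ht
    obtain ⟨n, hn1, hn2⟩ := h.exists_jumpTime ht0.le
    have hp := h.path_eq hn1 hn2
    rcases hn1.lt_or_eq with hlt | heq
    · exfalso
      have h1 : ∀ᶠ s in 𝓝[<] t, path ω s = (ω n).1 := by
        filter_upwards [Ioo_mem_nhdsLT hlt] with s hs
        exact h.path_eq hs.1.le (hs.2.trans hn2)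
      obtain ⟨s, hs1, hs2⟩ := (hy.and h1).exists
      exact hne (by rw [← hs1, hs2, hp])
    · obtain ⟨m, rfl⟩ : ∃ m, n = m + 1 := by
        refine Nat.exists_eq_succ_of_ne_zero fun h0 => ?_
        rw [h0, jumpTime_zero] at heq
        linarith
      rw [hp] at hA
      refine (iInf_le _ m).trans ?_
      rw [if_pos hA, heq]

-- Entry 0 of `ω` is ignored by `jumpHit A ω`, since no jump leads to it, but it becomes the target
-- of a jump after prepending. This explains the case distinction.
open Classical in
lemma jumpHit_consSeq (A : Set S) {a : S × ℝ} {ω : ℕ → S × ℝ} (h : Regular ω) (ha : 0 ≤ a.2) :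
    jumpHit A (consSeq a ω) =
      ENNReal.ofReal a.2 + if (ω 0).1 ∈ A then 0 else jumpHit A ω := by
  have h1 : jumpHit A (consSeq a ω) =
      ⨅ n, (ENNReal.ofReal a.2 + if (ω n).1 ∈ A then ENNReal.ofReal (jumpTime ω n) else ⊤) := by
    rw [jumpHit]
    refine iInf_congr fun n => ?_
    rw [consSeq_succ, jumpTime_consSeq]
    split_ifs
    · rw [ENNReal.ofReal_add ha (h.jumpTime_nonneg n)]
    · simp
  rw [h1, ← ENNReal.add_iInf]
  congr 1
  split_ifs with hA
  · refine le_antisymm ((iInf_le _ 0).trans ?_) zero_le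
    rw [if_pos hA, jumpTime_zero, ENNReal.ofReal_zero]
  · rw [jumpHit, ← inf_iInf_nat_succ, if_neg hA, top_inf_eq]

lemma path_consSeq {a : S × ℝ} {ω : ℕ → S × ℝ} (h : Regular ω) (t : ℝ) :
    path (consSeq a ω) t = if t < a.2 then a.1 else path ω (t - a.2) := by
  have key : ∀ n, t < jumpTime (consSeq a ω) (n + 1) ↔ t - a.2 < jumpTime ω n := fun n => by
    rw [jumpTime_consSeq, sub_lt_iff_lt_add']
  split_ifs with ht
  · have : sInf {n : ℕ | t < jumpTime (consSeq a ω) (n + 1)} = 0 := by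
      refine Nat.sInf_eq_zero.2 (Or.inl ?_)
      simp only [Set.mem_ofPred_eq, key, jumpTime_zero]
      linarith
    rw [path, this, consSeq_zero]
  · obtain ⟨n, hn1, hn2⟩ := h.exists_jumpTime (sub_nonneg.2 (not_lt.1 ht))
    have : sInf {k : ℕ | t < jumpTime (consSeq a ω) (k + 1)} = n + 1 := by
      have hmem : n + 1 ∈ {k : ℕ | t < jumpTime (consSeq a ω) (k + 1)} := (key _).2 hn2
      refine le_antisymm (Nat.sInf_le hmem) ?_
      by_contra! hlt
      have hm := (key _).1 (Nat.sInf_mem ⟨_, hmem⟩)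
      have := h.strictMono.monotone (Nat.le_of_lt_succ hlt)
      linarith
    rw [path, this, consSeq_succ, h.path_eq hn1 hn2]

lemma Regular.path_zero {ω : ℕ → S × ℝ} (h : Regular ω) : path ω 0 = (ω 0).1 :=
  h.path_eq (jumpTime_zero ω).le (by rw [jumpTime_succ, jumpTime_zero, zero_add]; exact h.pos 0)

end Regular

section Measurability

variable {S : Type} [MeasurableSpace S]

@[fun_prop]
lemma measurable_jumpTime (n : ℕ) : Measurable fun ω : ℕ → S × ℝ => jumpTime ω n := by
  unfold jumpTime
  fun_prop

lemma measurable_path [Countable S] [MeasurableSingletonClass S] :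
    Measurable fun p : (ℕ → S × ℝ) × ℝ => path p.1 p.2 := by
  have h1 : Measurable fun p : (ℕ → S × ℝ) × ℝ => sInf {n : ℕ | p.2 < jumpTime p.1 (n + 1)} := by
    have hlt : ∀ k, MeasurableSet {p : (ℕ → S × ℝ) × ℝ | p.2 < jumpTime p.1 (k + 1)} := fun k =>
      measurableSet_lt measurable_snd ((measurable_jumpTime _).comp measurable_fst)
    refine measurable_to_countable' fun n => ?_
    -- Since `sInf ∅ = 0`, the fibre over 0 also contains the pairs whose time is never exceeded by
    -- a jump time.
    have : (fun p : (ℕ → S × ℝ) × ℝ => sInf {n : ℕ | p.2 < jumpTime p.1 (n + 1)}) ⁻¹' {n} =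
        ({p | p.2 < jumpTime p.1 (n + 1)} ∩ ⋂ k, ⋂ (_ : k < n), {p | p.2 < jumpTime p.1 (k + 1)}ᶜ) ∪
          ({_p | n = 0} ∩ ⋂ k, {p | p.2 < jumpTime p.1 (k + 1)}ᶜ) := by
      ext p
      simp only [Set.mem_preimage, Set.mem_singleton_iff, Set.mem_union, Set.mem_inter_iff,
        Set.mem_ofPred_eq, Set.mem_iInter, Set.mem_compl_iff]
      constructor
      · rintro rfl
        by_cases hne : {n : ℕ | p.2 < jumpTime p.1 (n + 1)}.Nonempty
        · exact Or.inl ⟨Nat.sInf_mem hne, fun k hk => Nat.notMem_of_lt_sInf hk⟩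
        · rw [Set.not_nonempty_iff_eq_empty] at hne
          refine Or.inr ⟨by rw [hne]; exact Nat.sInf_empty, fun k hk => ?_⟩
          exact (Set.eq_empty_iff_forall_notMem.1 hne k) hk
      · rintro (⟨h1, h2⟩ | ⟨rfl, h2⟩)
        · refine le_antisymm (Nat.sInf_le h1) ?_
          by_contra! hlt
          exact h2 _ hlt (Nat.sInf_mem (s := {n : ℕ | p.2 < jumpTime p.1 (n + 1)}) ⟨n, h1⟩)
        · exact Nat.sInf_eq_zero.2 (Or.inr (Set.eq_empty_iff_forall_notMem.2 h2))
    rw [this]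
    refine ((hlt n).inter ?_).union ((MeasurableSet.const _).inter ?_)
    · exact MeasurableSet.iInter fun k => MeasurableSet.iInter fun _ => (hlt k).compl
    · exact MeasurableSet.iInter fun k => (hlt k).compl
  have h2 : Measurable fun p : (ℕ → S × ℝ) × ℕ => (p.1 p.2).1 :=
    measurable_from_prod_countable_left fun n => by fun_prop
  exact h2.comp (measurable_fst.prodMk h1)

lemma measurable_jumpHit [Countable S] [MeasurableSingletonClass S] (A : Set S) :
    Measurable (jumpHit A : (ℕ → S × ℝ) → ℝ≥0∞) := by
  classical
  refine Measurable.iInf fun n => ?_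
  refine Measurable.ite ?_ (by fun_prop) measurable_const
  exact (Set.to_countable A).measurableSet.preimage (measurable_fst.comp (measurable_pi_apply _))

end Measurability

/-! ### Exponential sojourn times -/

/-- The point 0 is null, so the open half-line carries the law. Positivity of sojourn times and the
integral formulas over `Ioi 0` rest on this form. -/
lemma expMeasure_eq_withDensity (r : ℝ) :
    expMeasure r = (volume.restrict (Set.Ioi (0 : ℝ))).withDensity
      fun s => ENNReal.ofReal (r * Real.exp (-(r * s))) := by
  have h1 : expMeasure r = volume.withDensity (exponentialPDF r) := rfl
  rw [h1, ← withDensity_indicator measurableSet_Ioi]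
  refine withDensity_congr_ae ?_
  have h0 : ∀ᵐ s : ℝ, s ≠ 0 := by simp [ae_iff, measure_singleton]
  filter_upwards [h0] with s hs
  rcases lt_or_gt_of_ne hs with h | h
  · rw [exponentialPDF_of_neg h, Set.indicator_of_notMem (by simpa using h.le)]
  · rw [exponentialPDF_of_nonneg h.le, Set.indicator_of_mem (by simpa using h)]

lemma ae_pos_expMeasure (r : ℝ) : ∀ᵐ s ∂expMeasure r, 0 < s := by
  rw [expMeasure_eq_withDensity]
  exact (withDensity_absolutelyContinuous _ _).ae_le (ae_restrict_mem measurableSet_Ioi)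

lemma integral_expMeasure {r : ℝ} (hr : 0 < r) (f : ℝ → ℂ) :
    ∫ s, f s ∂expMeasure r = ∫ s in Set.Ioi 0, (r * Real.exp (-(r * s)) : ℝ) * f s := by
  rw [expMeasure_eq_withDensity, integral_withDensity_eq_integral_toReal_smul (by fun_prop)
    (Eventually.of_forall fun _ => ENNReal.ofReal_lt_top)]
  refine integral_congr_ae (Eventually.of_forall fun s => ?_)
  simp only
  rw [ENNReal.toReal_ofReal (by positivity), Complex.real_smul]

/-- The Laplace transform of the exponential law. -/
lemma integral_exp_expMeasure {r : ℝ} (hr : 0 < r) {α : ℂ} (hα : 0 ≤ α.re) :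
    ∫ s : ℝ, Complex.exp (-α * s) ∂expMeasure r = r / (α + r) := by
  rw [integral_expMeasure hr]
  have h1 : ∀ s : ℝ, ((r * Real.exp (-(r * s)) : ℝ) : ℂ) * Complex.exp (-α * s) =
      r * Complex.exp (-(α + r) * s) := fun s => by
    push_cast
    rw [mul_assoc, ← Complex.exp_add]
    ring_nf
  simp only [h1]
  have hre : (-(α + r)).re < 0 := by simp; linarith
  rw [integral_const_mul, integral_exp_mul_complex_Ioi hre, Complex.ofReal_zero, mul_zero,
    Complex.exp_zero, neg_div_neg_eq, mul_one_div]

lemma lintegral_exp_expMeasure {r : ℝ} (hr : 0 < r) :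
    ∫⁻ s : ℝ, ENNReal.ofReal (Real.exp (-s)) ∂expMeasure r = ENNReal.ofReal (r / (1 + r)) := by
  rw [expMeasure_eq_withDensity, lintegral_withDensity_eq_lintegral_mul _ (by fun_prop)
    (by fun_prop)]
  have h1 : ∀ s : ℝ, ((fun s : ℝ => ENNReal.ofReal (r * Real.exp (-(r * s)))) *
      fun s : ℝ => ENNReal.ofReal (Real.exp (-s))) s =
        ENNReal.ofReal (r * Real.exp (-(1 + r) * s)) := fun s => by
    rw [Pi.mul_apply, ← ENNReal.ofReal_mul (by positivity), mul_assoc, ← Real.exp_add]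
    ring_nf
  have hneg : -(1 + r) < 0 := by linarith
  simp only [h1]
  rw [← ofReal_integral_eq_lintegral_ofReal ((integrableOn_exp_mul_Ioi hneg 0).const_mul r)
    (Eventually.of_forall fun s => by positivity), integral_const_mul, integral_exp_mul_Ioi hneg,
    mul_zero, Real.exp_zero, neg_div_neg_eq, mul_one_div]

section

variable {S : Type} [Countable S] [MeasurableSpace S] [MeasurableSingletonClass S]

lemma lintegral_chainLaw (q : S → S → ℝ≥0) (x : S) {f : (ℕ → S × ℝ) → ℝ≥0∞}
    (hf : Measurable f) :
    ∫⁻ ω, f ω ∂chainLaw q x =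
      ∫⁻ s, ∫⁻ y, ∫⁻ ω, f (consSeq (x, s) ω) ∂chainLaw q y ∂jumpKernel q x
        ∂expMeasure (holdRate q x) := by
  rw [chainLaw_eq_consLaw, lintegral_consLaw q x hf]

lemma ae_nextLaw (q : S → S → ℝ≥0) (x : S) {p : (ℕ → S × ℝ) → Prop}
    (h : ∀ᵐ y ∂jumpKernel q x, ∀ᵐ ω ∂chainLaw q y, p ω) : ∀ᵐ ω ∂nextLaw q x, p ω := by
  -- `p` need not be measurable. As `S` is countable, this intersection of measurable hulls is a
  -- measurable set containing the exceptional set, and it is null for every starting state where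
  -- `p` holds almost surely.
  let M : Set (ℕ → S × ℝ) := ⋂ y : {y // ∀ᵐ ω ∂chainLaw q y, p ω},
    toMeasurable (chainLaw q y) {ω | ¬ p ω}
  have hM : MeasurableSet M := MeasurableSet.iInter fun y => measurableSet_toMeasurable _ _
  have hsub : {ω | ¬ p ω} ⊆ M := Set.subset_iInter fun y => subset_toMeasurable _ _
  refine measure_mono_null hsub ?_
  rw [nextLaw, Measure.bind_apply hM (measurable_chainLaw q).aemeasurable]
  refine (lintegral_congr_ae (g := fun _ => 0) ?_).trans lintegral_zero
  filter_upwards [h] with y hy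
  refine measure_mono_null (Set.iInter_subset _ ⟨y, hy⟩) ?_
  rw [measure_toMeasurable]
  exact hy

/-- A property that holds for almost every first sojourn time and every continuation. -/
lemma ae_chainLaw (q : S → S → ℝ≥0) (x : S) {p : (ℕ → S × ℝ) → Prop}
    (hp : MeasurableSet {ω | p ω})
    (h : ∀ᵐ s ∂expMeasure (holdRate q x), ∀ᵐ y ∂jumpKernel q x, ∀ᵐ ω ∂chainLaw q y,
      p (consSeq (x, s) ω)) :
    ∀ᵐ ω ∂chainLaw q x, p ω := by
  have h1 := lintegral_chainLaw q x (measurable_one.indicator hp.compl)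
  rw [lintegral_indicator_one hp.compl] at h1
  rw [ae_iff]
  change chainLaw q x {ω | p ω}ᶜ = 0
  rw [h1]
  refine (lintegral_congr_ae (g := fun _ => 0) ?_).trans lintegral_zero
  filter_upwards [h] with s hs
  refine (lintegral_congr_ae (g := fun _ => 0) ?_).trans lintegral_zero
  filter_upwards [hs] with y hy
  refine (lintegral_congr_ae (g := fun _ => 0) ?_).trans lintegral_zero
  filter_upwards [hy] with ω hω
  exact Set.indicator_of_notMem (by simpa using hω) _

lemma ae_chainLaw_start (q : S → S → ℝ≥0) (x : S) : ∀ᵐ ω ∂chainLaw q x, (ω 0).1 = x := by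
  refine ae_chainLaw q x ?_ (by simp)
  exact (measurableSet_singleton x).preimage (f := fun ω : ℕ → S × ℝ => (ω 0).1) (by fun_prop)

lemma ae_sojourn_pos (q : S → S → ℝ≥0) (x : S) : ∀ᵐ ω ∂chainLaw q x, ∀ k, 0 < (ω k).2 := by
  rw [ae_all_iff]
  intro k
  induction k generalizing x with
  | zero =>
    refine ae_chainLaw q x (measurableSet_lt (by fun_prop) (by fun_prop)) ?_
    filter_upwards [ae_pos_expMeasure (holdRate q x)] with s hs
    simp [hs]
  | succ k ih =>
    refine ae_chainLaw q x (measurableSet_lt (by fun_prop) (by fun_prop)) ?_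
    simp only [consSeq_succ]
    exact Eventually.of_forall fun s => Eventually.of_forall fun y => ih y

lemma ae_jumpKernel_ne (q : S → S → ℝ≥0) {x : S} (h0 : exitRate q x ≠ 0)
    (h1 : exitRate q x ≠ ⊤) : ∀ᵐ y ∂jumpKernel q x, y ≠ x := by
  classical
  have h : jumpKernel q x = (jumpPMF q x).toMeasure := rfl
  have h2 : {y | ¬ y ≠ x} = {x} := by ext; simp
  have h3 : jumpPMF q x = PMF.normalize (jumpRate q x) h0 h1 := dif_pos ⟨h0, h1⟩
  have h4 := PMF.normalize_apply (f := jumpRate q x) h0 h1 x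
  rw [ae_iff, h2, h, PMF.toMeasure_apply_singleton _ _ (measurableSet_singleton x), h3]
  refine h4.trans ?_
  simp [jumpRate]

lemma ae_jump_ne (q : S → S → ℝ≥0) (h0 : ∀ x, exitRate q x ≠ 0) (h1 : ∀ x, exitRate q x ≠ ⊤)
    (x : S) : ∀ᵐ ω ∂chainLaw q x, ∀ k, (ω (k + 1)).1 ≠ (ω k).1 := by
  have hm : ∀ k, MeasurableSet {ω : ℕ → S × ℝ | (ω (k + 1)).1 ≠ (ω k).1} := fun k =>
    (measurableSet_eq_fun (f := fun ω : ℕ → S × ℝ => (ω (k + 1)).1)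
      (g := fun ω : ℕ → S × ℝ => (ω k).1) (by fun_prop) (by fun_prop)).compl
  rw [ae_all_iff]
  intro k
  induction k generalizing x with
  | zero =>
    refine ae_chainLaw q x (hm 0) (Eventually.of_forall fun s => ?_)
    filter_upwards [ae_jumpKernel_ne q (h0 x) (h1 x)] with y hy
    filter_upwards [ae_chainLaw_start q y] with ω hω
    simpa [hω] using hy
  | succ k ih =>
    refine ae_chainLaw q x (hm (k + 1)) ?_
    simp only [consSeq_succ]
    exact Eventually.of_forall fun s => Eventually.of_forall fun y => ih y

/-- A sojourn time with rate `r ≤ C` has Laplace transform `r / (1 + r) ≤ C / (1 + C)` at 1, and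
each jump contributes one such factor. -/
lemma lintegral_exp_jumpTime_le (q : S → S → ℝ≥0) {C : ℝ} (hC : ∀ x, holdRate q x ≤ C) (x : S)
    (n : ℕ) : ∫⁻ ω, ENNReal.ofReal (Real.exp (-jumpTime ω n)) ∂chainLaw q x ≤
      ENNReal.ofReal (C / (1 + C)) ^ n := by
  induction n generalizing x with
  | zero => simp [jumpTime_zero]
  | succ n ih =>
    rw [lintegral_chainLaw q x
      (f := fun ω => ENNReal.ofReal (Real.exp (-jumpTime ω (n + 1)))) (by fun_prop)]
    simp only [jumpTime_consSeq]
    have h1 : ∀ (s : ℝ) (ω : ℕ → S × ℝ), ENNReal.ofReal (Real.exp (-(s + jumpTime ω n))) =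
        ENNReal.ofReal (Real.exp (-s)) * ENNReal.ofReal (Real.exp (-jumpTime ω n)) := by
      intro s ω
      rw [← ENNReal.ofReal_mul (Real.exp_nonneg _), ← Real.exp_add, neg_add]
    simp only [h1]
    calc _ ≤ ∫⁻ s : ℝ, ENNReal.ofReal (Real.exp (-s)) * ENNReal.ofReal (C / (1 + C)) ^ n
            ∂expMeasure (holdRate q x) := by
          refine lintegral_mono fun s => ?_
          calc _ ≤ ∫⁻ _y, ENNReal.ofReal (Real.exp (-s)) * ENNReal.ofReal (C / (1 + C)) ^ n
                ∂jumpKernel q x := by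
                refine lintegral_mono fun y => ?_
                simp only
                rw [lintegral_const_mul _ (by fun_prop)]
                gcongr
                exact ih y
            _ = _ := by simp
      _ = ENNReal.ofReal (holdRate q x / (1 + holdRate q x)) * ENNReal.ofReal (C / (1 + C)) ^ n := by
          rw [lintegral_mul_const _ (by fun_prop), lintegral_exp_expMeasure (holdRate_pos q x)]
      _ ≤ _ := by
          rw [pow_succ']
          gcongr ENNReal.ofReal ?_ * _
          have := holdRate_pos q x
          have := hC x
          rw [div_le_div_iff₀ (by linarith) (by linarith)]
          nlinarith

/-- No explosion: the expectations of `exp (-T_n)` are dominated by a convergent geometric series,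
so almost surely the series of these exponentials converges and its terms tend to 0. -/
lemma ae_tendsto_jumpTime (q : S → S → ℝ≥0) {C : ℝ} (hC : ∀ x, holdRate q x ≤ C) (x : S) :
    ∀ᵐ ω ∂chainLaw q x, Tendsto (jumpTime ω) atTop atTop := by
  have hC0 : 0 < C := (holdRate_pos q x).trans_le (hC x)
  have h1 : ∫⁻ ω, ∑' n, ENNReal.ofReal (Real.exp (-jumpTime ω n)) ∂chainLaw q x ≠ ⊤ := by
    rw [lintegral_tsum fun n => by fun_prop]
    refine ne_top_of_le_ne_top ?_ (ENNReal.tsum_le_tsum fun n => lintegral_exp_jumpTime_le q hC x n)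
    rw [ENNReal.tsum_geometric]
    refine ENNReal.inv_ne_top.2 (tsub_pos_of_lt ?_).ne'
    rw [ENNReal.ofReal_lt_one, div_lt_one (by linarith)]
    linarith
  have h2 : Measurable fun ω : ℕ → S × ℝ => ∑' n, ENNReal.ofReal (Real.exp (-jumpTime ω n)) :=
    Measurable.tsum fun n => by fun_prop
  filter_upwards [ae_lt_top h2 h1] with ω hω
  have h3 := ENNReal.tendsto_atTop_zero_of_tsum_ne_top hω.ne
  have h4 := (ENNReal.tendsto_toReal ENNReal.zero_ne_top).comp h3
  simp only [ENNReal.toReal_zero] at h4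
  have h5 : Tendsto (fun n => Real.exp (-jumpTime ω n)) atTop (𝓝 0) :=
    h4.congr fun n => ENNReal.toReal_ofReal (Real.exp_nonneg _)
  exact tendsto_neg_atBot_iff.1 (Real.tendsto_exp_comp_nhds_zero.1 h5)

/-- The rates `q` have no absorbing state, and they are bounded. -/
structure BoundedRates (q : S → S → ℝ≥0) (C : ℝ) : Prop where
  ne_zero : ∀ x, exitRate q x ≠ 0
  ne_top : ∀ x, exitRate q x ≠ ⊤
  le : ∀ x, holdRate q x ≤ C

lemma BoundedRates.ae_regular {q : S → S → ℝ≥0} {C : ℝ} (hq : BoundedRates q C) (x : S) :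
    ∀ᵐ ω ∂chainLaw q x, Regular ω := by
  filter_upwards [ae_sojourn_pos q x, ae_tendsto_jumpTime q hq.le x,
    ae_jump_ne q hq.ne_zero hq.ne_top x] with ω h1 h2 h3
  exact ⟨h1, h2, h3⟩

end

/-! ### First-step analysis -/

section

variable {S : Type} [Countable S] [MeasurableSpace S] [MeasurableSingletonClass S]

lemma integral_nextLaw (q : S → S → ℝ≥0) (x : S) {V : (ℕ → S × ℝ) → ℂ}
    (hV : Integrable V (nextLaw q x)) :
    ∫ ω, V ω ∂nextLaw q x = ∫ y, ∫ ω, V ω ∂chainLaw q y ∂jumpKernel q x := by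
  let κ : Kernel S (ℕ → S × ℝ) := ⟨chainLaw q, measurable_chainLaw q⟩
  have : IsSFiniteKernel κ := by
    have : IsMarkovKernel κ := ⟨fun y => inferInstanceAs (IsProbabilityMeasure (chainLaw q y))⟩
    infer_instance
  have h : nextLaw q x = (κ ∘ₖ Kernel.const Unit (jumpKernel q x)) () := by
    rw [Kernel.comp_apply, Kernel.const_apply, nextLaw]
    rfl
  rw [h] at hV ⊢
  rw [Kernel.integral_comp hV, Kernel.const_apply]
  rfl

lemma BoundedRates.ae_regular_nextLaw {q : S → S → ℝ≥0} {C : ℝ} (hq : BoundedRates q C) (x : S) :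
    ∀ᵐ ω ∂nextLaw q x, Regular ω :=
  ae_nextLaw q x (Eventually.of_forall fun y => hq.ae_regular y)

/-- If `Z` is a sum of products of a function of the first sojourn time and a function of the
sequence from the second entry on, then its expectation is the corresponding sum of products. -/
lemma BoundedRates.integral_eq_sum {q : S → S → ℝ≥0} {C : ℝ} (hq : BoundedRates q C) (x : S)
    {ι : Type} (I : Finset ι) {Z : (ℕ → S × ℝ) → ℂ} {b : ι → ℝ → ℂ} {V : ι → (ℕ → S × ℝ) → ℂ}
    (hZ : AEStronglyMeasurable Z (chainLaw q x))
    (hb : ∀ i ∈ I, Integrable (b i) (expMeasure (holdRate q x)))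
    (hV : ∀ i ∈ I, Integrable (V i) (nextLaw q x))
    (h : ∀ s ω, 0 < s → Regular ω → Z (consSeq (x, s) ω) = ∑ i ∈ I, b i s * V i ω) :
    ∫ ω, Z ω ∂chainLaw q x =
      ∑ i ∈ I, (∫ s, b i s ∂expMeasure (holdRate q x)) *
        ∫ y, ∫ ω, V i ω ∂chainLaw q y ∂jumpKernel q x := by
  have hm := measurable_consSeq_pair x
  rw [chainLaw_eq_consLaw, consLaw] at hZ ⊢
  rw [integral_map hm.aemeasurable hZ]
  have h1 : ∀ᵐ p ∂(expMeasure (holdRate q x)).prod (nextLaw q x), 0 < p.1 :=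
    Measure.quasiMeasurePreserving_fst.ae (ae_pos_expMeasure _)
  have h2 : ∀ᵐ p ∂(expMeasure (holdRate q x)).prod (nextLaw q x), Regular p.2 :=
    Measure.quasiMeasurePreserving_snd.ae (hq.ae_regular_nextLaw x)
  have h3 : (fun p : ℝ × (ℕ → S × ℝ) => Z (consSeq (x, p.1) p.2))
      =ᵐ[(expMeasure (holdRate q x)).prod (nextLaw q x)]
        fun p => ∑ i ∈ I, b i p.1 * V i p.2 := by
    filter_upwards [h1, h2] with p hp1 hp2 using h p.1 p.2 hp1 hp2
  rw [integral_congr_ae h3, integral_finsetSum I fun i hi => (hb i hi).mul_prod (hV i hi)]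
  refine Finset.sum_congr rfl fun i hi => ?_
  rw [integral_prod_mul, integral_nextLaw q x (hV i hi)]

end

/-! ### Discounted rewards up to a transition into a set. -/

section Functional

variable {S : Type}

lemma measurable_discount (α : ℂ) : Measurable (discount α) := by
  unfold discount
  exact Measurable.ite (measurableSet_singleton _) measurable_const (by fun_prop)

lemma discount_top (α : ℂ) : discount α ⊤ = 0 := if_pos rfl

lemma discount_zero (α : ℂ) : discount α 0 = 1 := by simp [discount]

lemma discount_add (α : ℂ) {s : ℝ} (hs : 0 ≤ s) (τ : ℝ≥0∞) :
    discount α (ENNReal.ofReal s + τ) = Complex.exp (-α * s) * discount α τ := by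
  by_cases h : τ = ⊤
  · simp [h, discount_top]
  · rw [discount, discount, if_neg (by simp [h]), if_neg h,
      ENNReal.toReal_add ENNReal.ofReal_ne_top h, ENNReal.toReal_ofReal hs, ← Complex.exp_add]
    push_cast
    ring_nf

lemma norm_exp_neg_mul (α : ℂ) (t : ℝ) : ‖Complex.exp (-α * t)‖ = Real.exp (-α.re * t) := by
  simp [Complex.norm_exp]

lemma norm_discount_le {α : ℂ} (hα : 0 ≤ α.re) (τ : ℝ≥0∞) : ‖discount α τ‖ ≤ 1 := by
  rw [discount]
  split_ifs
  · simp
  · rw [norm_exp_neg_mul, Real.exp_le_one_iff]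
    have : 0 ≤ τ.toReal := ENNReal.toReal_nonneg
    nlinarith

/-- The discounted reward `f` collected until the time `τ`. -/
def reward (α : ℂ) (f : S → ℂ) (X : ℝ → S) (τ : ℝ≥0∞) : ℂ :=
  ∫ t in {t : ℝ | 0 ≤ t ∧ ENNReal.ofReal t < τ}, Complex.exp (-α * t) * f (X t)

lemma measurableSet_before (τ : ℝ≥0∞) : MeasurableSet {t : ℝ | 0 ≤ t ∧ ENNReal.ofReal t < τ} :=
  (measurableSet_le measurable_const measurable_id).inter
    (measurableSet_lt ENNReal.measurable_ofReal measurable_const)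

lemma integrableOn_exp_Ici {a : ℝ} (ha : 0 < a) :
    IntegrableOn (fun t : ℝ => Real.exp (-a * t)) (Set.Ici 0) :=
  (integrableOn_Ici_iff_integrableOn_Ioi (by simp)).2
    (integrableOn_exp_mul_Ioi (by linarith) 0)

lemma integral_exp_Ici {a : ℝ} (ha : 0 < a) :
    ∫ t in Set.Ici (0 : ℝ), Real.exp (-a * t) = 1 / a := by
  rw [integral_Ici_eq_integral_Ioi, integral_exp_mul_Ioi (by linarith), mul_zero, Real.exp_zero,
    neg_div_neg_eq]

lemma integrableOn_reward {α : ℂ} (hα : 0 < α.re) {f : S → ℂ} {C : ℝ} (hf : ∀ x, ‖f x‖ ≤ C)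
    {X : ℝ → S} (hX : Measurable fun t => f (X t)) (τ : ℝ≥0∞) :
    IntegrableOn (fun t : ℝ => Complex.exp (-α * t) * f (X t))
      {t : ℝ | 0 ≤ t ∧ ENNReal.ofReal t < τ} := by
  refine IntegrableOn.mono_set (t := Set.Ici 0) ?_ fun t ht => ht.1
  have hm : Measurable fun t : ℝ => Complex.exp (-α * t) := by fun_prop
  refine Integrable.mono' ((integrableOn_exp_Ici hα).mul_const C)
    (hm.mul hX).aestronglyMeasurable (Eventually.of_forall fun t => ?_)
  rw [norm_mul, norm_exp_neg_mul]
  gcongr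
  exact hf _

lemma norm_reward_le {α : ℂ} (hα : 0 < α.re) {f : S → ℂ} {C : ℝ} (hC : 0 ≤ C)
    (hf : ∀ x, ‖f x‖ ≤ C) (X : ℝ → S) (τ : ℝ≥0∞) : ‖reward α f X τ‖ ≤ C / α.re := by
  have hi : IntegrableOn (fun t : ℝ => Real.exp (-α.re * t) * C) (Set.Ici 0) :=
    (integrableOn_exp_Ici hα).mul_const C
  calc ‖reward α f X τ‖
      ≤ ∫ t in {t : ℝ | 0 ≤ t ∧ ENNReal.ofReal t < τ}, Real.exp (-α.re * t) * C := by
        refine norm_integral_le_of_norm_le (hi.mono_set fun t ht => ht.1)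
          (Eventually.of_forall fun t => ?_)
        rw [norm_mul, norm_exp_neg_mul]
        gcongr
        exact hf _
    _ ≤ ∫ t in Set.Ici (0 : ℝ), Real.exp (-α.re * t) * C :=
        setIntegral_mono_set hi (Eventually.of_forall fun t => by positivity)
          (Eventually.of_forall fun t ht => ht.1)
    _ = C / α.re := by
        rw [integral_mul_const, integral_exp_Ici hα]
        ring

lemma integral_exp_Ico {α : ℂ} (hα : α ≠ 0) {s : ℝ} (hs : 0 ≤ s) :
    ∫ t in Set.Ico (0 : ℝ) s, Complex.exp (-α * t) = (1 - Complex.exp (-α * s)) / α := by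
  rw [integral_Ico_eq_integral_Ioc, ← intervalIntegral.integral_of_le hs,
    integral_exp_mul_complex (neg_ne_zero.2 hα), Complex.ofReal_zero, mul_zero, Complex.exp_zero,
    div_neg, ← neg_div, neg_sub]

/-- Splitting the reward at the time of the first jump. -/
lemma reward_consSeq {α : ℂ} (hα : 0 < α.re) {f : S → ℂ} {C : ℝ} (hf : ∀ x, ‖f x‖ ≤ C)
    {x : S} {s : ℝ} (hs : 0 < s) {ω : ℕ → S × ℝ} (hω : Regular ω)
    (hm : Measurable fun t => f (path ω t)) (τ : ℝ≥0∞) :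
    reward α f (path (consSeq (x, s) ω)) (ENNReal.ofReal s + τ) =
      f x * ((1 - Complex.exp (-α * s)) / α) +
        Complex.exp (-α * s) * reward α f (path ω) τ := by
  have hα0 : α ≠ 0 := fun h => by simp [h] at hα
  have hset : MeasurableSet {t : ℝ | 0 ≤ t ∧ ENNReal.ofReal t < τ} := measurableSet_before τ
  let H : ℝ → ℂ := Set.indicator {t : ℝ | 0 ≤ t ∧ ENNReal.ofReal t < τ}
    fun t : ℝ => Complex.exp (-α * t) * f (path ω t)
  have hH : Integrable H := (integrable_indicator_iff hset).2 (integrableOn_reward hα hf hm τ)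
  let F : ℝ → ℂ := Set.indicator (Set.Ico 0 s) fun t : ℝ => Complex.exp (-α * t)
  have hF : Integrable F := (integrable_indicator_iff measurableSet_Ico).2
    ((by fun_prop : Continuous fun t : ℝ => Complex.exp (-α * t)).integrableOn_Icc.mono_set
      Set.Ico_subset_Icc_self)
  -- Until time `s` the path rests in `x`; afterwards the integrand is that of `ω` translated by
  -- `s`. Translation invariance of Lebesgue measure then gives the two summands.
  have key : ∀ t : ℝ, Set.indicator {t : ℝ | 0 ≤ t ∧ ENNReal.ofReal t < ENNReal.ofReal s + τ}
      (fun t : ℝ => Complex.exp (-α * t) * f (path (consSeq (x, s) ω) t)) t =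
        f x * F t + Complex.exp (-α * s) * H (t - s) := by
    intro t
    rcases lt_or_ge t s with hts | hts
    · have h0 : H (t - s) = 0 := Set.indicator_of_notMem (fun h => by
        have := h.1; linarith) _
      rw [h0, mul_zero, add_zero]
      by_cases ht0 : 0 ≤ t
      · have h1 : ENNReal.ofReal t < ENNReal.ofReal s + τ :=
          ((ENNReal.ofReal_lt_ofReal_iff hs).2 hts).trans_le le_self_add
        rw [Set.indicator_of_mem (Set.mem_ofPred_eq ▸ ⟨ht0, h1⟩)]
        simp only [F]
        rw [Set.indicator_of_mem (show t ∈ Set.Ico 0 s from ⟨ht0, hts⟩), path_consSeq hω, if_pos hts,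
          mul_comm]
      · rw [Set.indicator_of_notMem fun h => ht0 h.1]
        simp only [F]
        rw [Set.indicator_of_notMem fun h => ht0 h.1, mul_zero]
    · have h0 : F t = 0 := Set.indicator_of_notMem (fun h => not_lt.2 hts h.2) _
      have hts0 : 0 ≤ t - s := sub_nonneg.2 hts
      have h1 : ENNReal.ofReal t < ENNReal.ofReal s + τ ↔ ENNReal.ofReal (t - s) < τ := by
        have : t = s + (t - s) := by ring
        rw [this, ENNReal.ofReal_add hs.le hts0, ← this]
        exact ENNReal.add_lt_add_iff_left ENNReal.ofReal_ne_top
      rw [h0, mul_zero, zero_add]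
      simp only [H]
      by_cases h2 : ENNReal.ofReal (t - s) < τ
      · rw [Set.indicator_of_mem (Set.mem_ofPred_eq ▸ ⟨hs.le.trans hts, h1.2 h2⟩),
          Set.indicator_of_mem (Set.mem_ofPred_eq ▸ ⟨hts0, h2⟩), path_consSeq hω,
          if_neg (not_lt.2 hts), ← mul_assoc, ← Complex.exp_add]
        congr 2
        push_cast
        ring_nf
      · rw [Set.indicator_of_notMem fun h => h2 (h1.1 h.2), Set.indicator_of_notMem fun h => h2 h.2,
          mul_zero]
  rw [reward, ← integral_indicator (measurableSet_before _), integral_congr_ae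
    (Eventually.of_forall key), integral_add (hF.const_mul _) ((hH.comp_sub_right s).const_mul _),
    integral_const_mul, integral_const_mul, integral_sub_right_eq_self H s]
  simp only [F, H]
  rw [integral_indicator measurableSet_Ico, integral_indicator hset, integral_exp_Ico hα0 hs.le,
    reward]

/-- The discounted reward `f` collected until the first transition into `A`, plus the discounted
reward `g` received at that time. -/
def total (α : ℂ) (A : Set S) (f g : S → ℂ) (ω : ℕ → S × ℝ) : ℂ :=
  reward α f (path ω) (jumpHit A ω) +
    discount α (jumpHit A ω) * g (path ω (jumpHit A ω).toReal)

lemma norm_total_le {α : ℂ} (hα : 0 < α.re) (A : Set S) {f g : S → ℂ} {C D : ℝ} (hC : 0 ≤ C)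
    (hf : ∀ x, ‖f x‖ ≤ C) (hg : ∀ x, ‖g x‖ ≤ D) (ω : ℕ → S × ℝ) :
    ‖total α A f g ω‖ ≤ C / α.re + D := by
  refine (norm_add_le _ _).trans (add_le_add (norm_reward_le hα hC hf _ _) ?_)
  rw [norm_mul]
  calc _ ≤ 1 * ‖g (path ω (jumpHit A ω).toReal)‖ := by
        gcongr
        exact norm_discount_le hα.le _
    _ ≤ D := by rw [one_mul]; exact hg _

variable [Countable S] [MeasurableSpace S] [MeasurableSingletonClass S]

lemma measurable_comp_path {β : Type} [MeasurableSpace β] (f : S → β) :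
    Measurable fun p : (ℕ → S × ℝ) × ℝ => f (path p.1 p.2) :=
  (measurable_of_countable f).comp measurable_path

lemma measurable_comp_path_right {β : Type} [MeasurableSpace β] (f : S → β) (ω : ℕ → S × ℝ) :
    Measurable fun t => f (path ω t) :=
  (measurable_comp_path f).comp (f := fun t : ℝ => (ω, t)) (by fun_prop)

lemma measurable_total (α : ℂ) (A : Set S) (f g : S → ℂ) : Measurable (total α A f g) := by
  have hJ := measurable_jumpHit A
  refine Measurable.add ?_ ?_
  · have h1 : ∀ ω, reward α f (path ω) (jumpHit A ω) =
        ∫ t : ℝ, Set.indicator {p : (ℕ → S × ℝ) × ℝ | 0 ≤ p.2 ∧ ENNReal.ofReal p.2 < jumpHit A p.1}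
          (fun p => Complex.exp (-α * p.2) * f (path p.1 p.2)) (ω, t) := fun ω => by
      rw [reward, ← integral_indicator (measurableSet_before _)]
      rfl
    simp only [h1]
    have hset : MeasurableSet
        {p : (ℕ → S × ℝ) × ℝ | 0 ≤ p.2 ∧ ENNReal.ofReal p.2 < jumpHit A p.1} :=
      (measurableSet_le measurable_const measurable_snd).inter
        (measurableSet_lt (ENNReal.measurable_ofReal.comp measurable_snd)
          (hJ.comp measurable_fst))
    have he : Measurable fun p : (ℕ → S × ℝ) × ℝ => Complex.exp (-α * p.2) := by fun_prop
    exact (((he.mul (measurable_comp_path f)).indicator hset).stronglyMeasurable.integral_prod_right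
      (f := fun ω t => Set.indicator
        {p : (ℕ → S × ℝ) × ℝ | 0 ≤ p.2 ∧ ENNReal.ofReal p.2 < jumpHit A p.1}
          (fun p => Complex.exp (-α * p.2) * f (path p.1 p.2)) (ω, t))).measurable
  · exact ((measurable_discount α).comp hJ).mul
      ((measurable_comp_path g).comp (measurable_id.prodMk hJ.ennreal_toReal))

-- If the first jump lands in `A`, the residual time is 0: no further reward is collected and `g` is
-- paid at once, undiscounted apart from the first sojourn.
open Classical in
lemma total_consSeq {α : ℂ} (hα : 0 < α.re) (A : Set S) {f : S → ℂ} (g : S → ℂ) {C : ℝ}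
    (hf : ∀ x, ‖f x‖ ≤ C) {x : S} {s : ℝ} (hs : 0 < s) {ω : ℕ → S × ℝ} (hω : Regular ω) :
    total α A f g (consSeq (x, s) ω) = f x * ((1 - Complex.exp (-α * s)) / α) +
      Complex.exp (-α * s) * if (ω 0).1 ∈ A then g (ω 0).1 else total α A f g ω := by
  have hτ := jumpHit_consSeq A (a := (x, s)) hω hs.le
  simp only at hτ
  set σ : ℝ≥0∞ := if (ω 0).1 ∈ A then 0 else jumpHit A ω with hσ
  have h1 : total α A f g (consSeq (x, s) ω) = f x * ((1 - Complex.exp (-α * s)) / α) +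
      Complex.exp (-α * s) * (reward α f (path ω) σ + discount α σ * g (path ω σ.toReal)) := by
    rw [total, hτ, reward_consSeq hα hf hs hω (measurable_comp_path_right f ω), discount_add α hs.le]
    by_cases h : σ = ⊤
    · simp [h, discount_top]
    · rw [path_consSeq hω, ENNReal.toReal_add ENNReal.ofReal_ne_top h, ENNReal.toReal_ofReal hs.le,
        if_neg (not_lt.2 (le_add_of_nonneg_right ENNReal.toReal_nonneg)), add_sub_cancel_left]
      ring
  rw [h1]
  congr 2
  by_cases hA : (ω 0).1 ∈ A
  · rw [if_pos hA] at hσ ⊢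
    rw [hσ, discount_zero, ENNReal.toReal_zero, hω.path_zero]
    simp [reward]
  · rw [if_neg hA] at hσ ⊢
    rw [hσ, total]

/-- The expectation of `total`. -/
def meanTotal (q : S → S → ℝ≥0) (α : ℂ) (A : Set S) (f g : S → ℂ) (x : S) : ℂ :=
  ∫ ω, total α A f g ω ∂chainLaw q x

lemma norm_meanTotal_le (q : S → S → ℝ≥0) {α : ℂ} (hα : 0 < α.re) (A : Set S) {f g : S → ℂ}
    {C D : ℝ} (hC : 0 ≤ C) (hf : ∀ x, ‖f x‖ ≤ C) (hg : ∀ x, ‖g x‖ ≤ D) (x : S) :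
    ‖meanTotal q α A f g x‖ ≤ C / α.re + D := by
  refine (norm_integral_le_of_norm_le_const
    (Eventually.of_forall (norm_total_le hα A hC hf hg))).trans ?_
  simp

open Classical in
/-- The first-step equation for the expected discounted reward. -/
theorem BoundedRates.meanTotal_eq {q : S → S → ℝ≥0} {B : ℝ} (hq : BoundedRates q B) {α : ℂ}
    (hα : 0 < α.re) (A : Set S) {f g : S → ℂ} {C D : ℝ} (hC : 0 ≤ C) (hf : ∀ x, ‖f x‖ ≤ C)
    (hg : ∀ x, ‖g x‖ ≤ D) (x : S) :
    (α + holdRate q x) * meanTotal q α A f g x = f x + holdRate q x *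
      ∫ y, (if y ∈ A then g y else meanTotal q α A f g y) ∂jumpKernel q x := by
  have hr := holdRate_pos q x
  have hα0 : α ≠ 0 := fun h => by simp [h] at hα
  have hαr : α + holdRate q x ≠ 0 := fun h => by
    have := congrArg Complex.re h
    simp at this
    linarith
  let V : (ℕ → S × ℝ) → ℂ := fun ω => if (ω 0).1 ∈ A then g (ω 0).1 else total α A f g ω
  have hV : Measurable V := by
    refine Measurable.ite ?_ ?_ (measurable_total α A f g)
    · exact (Set.to_countable A).measurableSet.preimage (measurable_fst.comp (measurable_pi_apply _))
    · exact (measurable_of_countable g).comp (measurable_fst.comp (measurable_pi_apply _))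
  have hVb : ∀ ω, ‖V ω‖ ≤ C / α.re + D := fun ω => by
    simp only [V]
    split_ifs
    · exact (hg _).trans (le_add_of_nonneg_left (by positivity))
    · exact norm_total_le hα A hC hf hg ω
  have hE : Integrable (fun s : ℝ => Complex.exp (-α * s)) (expMeasure (holdRate q x)) := by
    refine Integrable.of_bound (C := 1) (by fun_prop) ?_
    filter_upwards [ae_pos_expMeasure (holdRate q x)] with s hs
    rw [norm_exp_neg_mul, Real.exp_le_one_iff]
    nlinarith
  -- The index `true` stands for the reward earned in `x` during the first sojourn, and `false` for
  -- the discounted continuation.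
  have key := hq.integral_eq_sum x (Finset.univ : Finset Bool) (Z := total α A f g)
    (b := fun i s => bif i then f x * ((1 - Complex.exp (-α * s)) / α) else Complex.exp (-α * s))
    (V := fun i => bif i then fun _ => 1 else V)
    (measurable_total α A f g).aestronglyMeasurable
    (by
      rintro (_ | _) -
      · exact hE
      · exact (((integrable_const 1).sub hE).div_const α).const_mul _)
    (by
      rintro (_ | _) -
      · exact Integrable.of_bound hV.aestronglyMeasurable _ (Eventually.of_forall hVb)
      · exact integrable_const _)
    (by
      intro s ω hs hω
      simp [total_consSeq hα A g hf hs hω, V])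
  simp only [Fintype.sum_bool, cond_true, cond_false, integral_const, probReal_univ, one_smul,
    mul_one] at key
  rw [integral_const_mul, integral_div, integral_sub (integrable_const _) hE,
    integral_exp_expMeasure hr hα.le] at key
  simp only [integral_const, probReal_univ, one_smul] at key
  have h2 : ∀ y, ∫ ω, V ω ∂chainLaw q y = if y ∈ A then g y else meanTotal q α A f g y := by
    intro y
    have h3 : V =ᵐ[chainLaw q y] fun ω => if y ∈ A then g y else total α A f g ω := by
      filter_upwards [ae_chainLaw_start q y] with ω hω
      simp only [V, hω]
    rw [integral_congr_ae h3]
    split_ifs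
    · simp
    · rfl
  simp only [h2] at key
  rw [meanTotal, key]
  field_simp
  ring

end Functional

/-! ### Chains with finitely many jumps out of each state -/

section FiniteJumps

variable {S ι : Type} [Fintype ι]

open Classical in
/-- The jumps out of `x` are the ones to the states `t i`, with rates `w i`. -/
def HasJumps (q : S → S → ℝ≥0) (x : S) (t : ι → S) (w : ι → ℝ≥0) : Prop :=
  ∀ y, jumpRate q x y = ∑ i, if y = t i then (w i : ℝ≥0∞) else 0

variable {q : S → S → ℝ≥0} {x : S} {t : ι → S} {w : ι → ℝ≥0}

lemma HasJumps.exitRate_eq (h : HasJumps q x t w) : exitRate q x = ((∑ i, w i : ℝ≥0) : ℝ≥0∞) := by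
  classical
  simp only [exitRate, h _]
  rw [Summable.tsum_finsetSum fun _ _ => ENNReal.summable, ENNReal.ofNNReal_finsetSum]
  exact Finset.sum_congr rfl fun i _ => tsum_ite_eq (t i) fun _ => (w i : ℝ≥0∞)

lemma HasJumps.exitRate_ne_top (h : HasJumps q x t w) : exitRate q x ≠ ⊤ := by
  rw [h.exitRate_eq]; exact ENNReal.coe_ne_top

lemma HasJumps.exitRate_ne_zero (h : HasJumps q x t w) (hw : 0 < ∑ i, w i) :
    exitRate q x ≠ 0 := by
  rw [h.exitRate_eq, ENNReal.coe_ne_zero]; exact hw.ne'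

lemma HasJumps.holdRate_eq (h : HasJumps q x t w) (hw : 0 < ∑ i, w i) :
    holdRate q x = ∑ i, (w i : ℝ) := by
  rw [holdRate, if_pos ⟨h.exitRate_ne_zero hw, h.exitRate_ne_top⟩, h.exitRate_eq, ENNReal.coe_toReal,
    NNReal.coe_sum]

variable [Countable S] [MeasurableSpace S] [MeasurableSingletonClass S]

lemma HasJumps.jumpKernel_eq (h : HasJumps q x t w) (hw : 0 < ∑ i, w i) :
    jumpKernel q x = ∑ i, (w i / ∑ j, w j : ℝ≥0) • Measure.dirac (t i) := by
  classical
  have h0 : jumpKernel q x = (jumpPMF q x).toMeasure := rfl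
  have h3 : jumpPMF q x = PMF.normalize (jumpRate q x) (h.exitRate_ne_zero hw) h.exitRate_ne_top :=
    dif_pos ⟨h.exitRate_ne_zero hw, h.exitRate_ne_top⟩
  refine Measure.ext_of_singleton fun y => ?_
  have h4 := PMF.normalize_apply (f := jumpRate q x) (h.exitRate_ne_zero hw) h.exitRate_ne_top y
  rw [h0, PMF.toMeasure_apply_singleton _ _ (measurableSet_singleton y), h3]
  refine h4.trans ?_
  have h5 : ∑' y, jumpRate q x y = ((∑ i, w i : ℝ≥0) : ℝ≥0∞) := h.exitRate_eq
  rw [h5, h y, Measure.finsetSum_apply, Finset.sum_mul]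
  refine Finset.sum_congr rfl fun i _ => ?_
  rw [Measure.smul_apply, Measure.dirac_apply' _ (measurableSet_singleton y)]
  by_cases hy : y = t i
  · rw [if_pos hy, Set.indicator_of_mem (by simp [hy]), Pi.one_apply, ENNReal.smul_def,
      ENNReal.coe_div hw.ne', smul_eq_mul, mul_one, div_eq_mul_inv]
  · rw [if_neg hy, Set.indicator_of_notMem (by simpa using fun h => hy h.symm)]
    simp

/-- The holding rate cancels the normalization of the jump probabilities. This turns first-step
equations into equations for the generator. -/
lemma HasJumps.integral_eq (h : HasJumps q x t w) (hw : 0 < ∑ i, w i) (f : S → ℂ) :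
    holdRate q x * ∫ y, f y ∂jumpKernel q x = ∑ i, (w i : ℝ) * f (t i) := by
  have hi : ∀ i, Integrable f ((w i / ∑ j, w j : ℝ≥0) • Measure.dirac (t i)) := fun i =>
    (integrable_dirac (by simp)).smul_measure_nnreal
  rw [h.jumpKernel_eq hw, integral_finsetSum_measure fun i _ => hi i, h.holdRate_eq hw,
    Finset.mul_sum]
  refine Finset.sum_congr rfl fun i _ => ?_
  have h0 : ((∑ i, (w i : ℝ) : ℝ) : ℂ) ≠ 0 := by
    rw [← NNReal.coe_sum]
    exact_mod_cast hw.ne'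
  rw [integral_smul_nnreal_measure, integral_dirac, NNReal.smul_def, Complex.real_smul]
  push_cast at h0 ⊢
  field_simp

end FiniteJumps

/-! ### Jump lists and rate bounds of the three chains. -/

/-- At `n = 0` truncated subtraction makes the second target the state itself, so its weight has to
be 0. The priority queue below behaves likewise, where the minima in its weights vanish. -/
lemma mm1Rate_hasJumps (lam mu : ℝ≥0) (n : ℕ) :
    HasJumps (mm1Rate lam mu) n ![n + 1, n - 1] ![lam, if n = 0 then 0 else mu] := by
  intro y
  simp only [jumpRate, mm1Rate, Fin.sum_univ_two, Matrix.cons_val_zero, Matrix.cons_val_one]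
  rcases n with _ | n
  · by_cases h : y = 0 + 1 <;> by_cases h' : y = 0 <;> simp_all
  · by_cases h1 : y = n + 1 + 1
    · have h2 : n + 1 + 1 ≠ n := by omega
      simp [h1, h2]
    · by_cases h2 : y = n
      · have h4 : n ≠ n + 1 + 1 := by omega
        simp [h2, h4]
      · by_cases h3 : y = n + 1
        · simp [h3]
        · simp [h1, h2, h3]

lemma poissonRate_hasJumps (th : ℝ≥0) (n : ℕ) :
    HasJumps (poissonRate th) n ![n + 1] ![th] := by
  intro y
  simp only [jumpRate, poissonRate, Fin.sum_univ_one, Matrix.cons_val_zero]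
  by_cases h1 : y = n + 1
  · simp [h1]
  · by_cases h3 : y = n <;> simp [h1, h3]

lemma mm1Rate_bounded {lam mu : ℝ≥0} (hlam : 0 < lam) :
    BoundedRates (mm1Rate lam mu) (lam + mu) := by
  have hw : ∀ n : ℕ, 0 < ∑ i, (![lam, if n = 0 then 0 else mu] : Fin 2 → ℝ≥0) i := fun n => by
    simp only [Fin.sum_univ_two, Matrix.cons_val_zero, Matrix.cons_val_one]
    exact add_pos_of_pos_of_nonneg hlam zero_le
  refine ⟨fun n => (mm1Rate_hasJumps lam mu n).exitRate_ne_zero (hw n),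
    fun n => (mm1Rate_hasJumps lam mu n).exitRate_ne_top, fun n => ?_⟩
  rw [(mm1Rate_hasJumps lam mu n).holdRate_eq (hw n)]
  simp only [Fin.sum_univ_two, Matrix.cons_val_zero, Matrix.cons_val_one]
  split_ifs <;> simp

lemma poissonRate_bounded {th : ℝ≥0} (hth : 0 < th) : BoundedRates (poissonRate th) th := by
  have hw : 0 < ∑ i, (![th] : Fin 1 → ℝ≥0) i := by simpa using hth
  refine ⟨fun n => (poissonRate_hasJumps th n).exitRate_ne_zero hw,
    fun n => (poissonRate_hasJumps th n).exitRate_ne_top, fun n => ?_⟩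
  rw [(poissonRate_hasJumps th n).holdRate_eq hw]
  simp

namespace Params

variable (M : Params)

/-- The target states of the four kinds of transitions out of `x`. -/
def target (x : ℕ × ℕ) : Fin 4 → ℕ × ℕ :=
  ![(x.1 + 1, x.2), (x.1, x.2 + 1), (x.1 - 1, x.2), (x.1, x.2 - 1)]

/-- The rates of the four kinds of transitions out of `x`. -/
def weight (x : ℕ × ℕ) : Fin 4 → ℝ≥0 :=
  ![M.lam₁, M.lam₂, ((min x.1 (M.c - x.2) : ℕ) : ℝ≥0) * M.mu₁, ((min M.c x.2 : ℕ) : ℝ≥0) * M.mu₂]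

lemma rate_hasJumps (x : ℕ × ℕ) : HasJumps M.rate x (target x) (M.weight x) := by
  rintro ⟨a, b⟩
  obtain ⟨i, j⟩ := x
  simp only [jumpRate, rate, target, weight, Fin.sum_univ_four, Matrix.cons_val, Prod.mk.injEq]
  rcases i with _ | i <;> rcases j with _ | j <;>
  · simp only [Nat.zero_min, Nat.min_zero, Nat.cast_zero, zero_mul, ENNReal.coe_zero, ite_self,
      add_zero, zero_add, Nat.add_sub_cancel]
    split_ifs <;> first | omega | simp

lemma weight_pos (h : 0 < M.lam₁) (x : ℕ × ℕ) : 0 < ∑ i, M.weight x i := by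
  simp only [weight, Fin.sum_univ_four, Matrix.cons_val]
  positivity

lemma rate_bounded (h : 0 < M.lam₁) :
    BoundedRates M.rate (M.lam₁ + M.lam₂ + M.c * M.mu₁ + M.c * M.mu₂) := by
  refine ⟨fun x => (M.rate_hasJumps x).exitRate_ne_zero (M.weight_pos h x),
    fun x => (M.rate_hasJumps x).exitRate_ne_top, fun x => ?_⟩
  rw [(M.rate_hasJumps x).holdRate_eq (M.weight_pos h x)]
  simp only [weight, Fin.sum_univ_four, Matrix.cons_val, NNReal.coe_mul, NNReal.coe_natCast]
  gcongr
  · exact (min_le_right _ _).trans (Nat.sub_le _ _)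
  · exact min_le_left _ _

end Params

/-! ### The Poisson process -/

/-- The probability of `m` points of a Poisson process of rate `th` up to time `t`. -/
def poissonProb (th : ℝ≥0) (m : ℕ) (t : ℝ) : ℝ :=
  Real.exp (-(th * t)) * (th * t) ^ m / m.factorial

lemma continuous_poissonProb (th : ℝ≥0) (m : ℕ) : Continuous (poissonProb th m) := by
  unfold poissonProb
  fun_prop

lemma poissonProb_nonneg (th : ℝ≥0) (m : ℕ) {t : ℝ} (ht : 0 ≤ t) : 0 ≤ poissonProb th m t := by
  unfold poissonProb
  positivity

lemma sum_poissonProb_le (th : ℝ≥0) (n : ℕ) {t : ℝ} (ht : 0 ≤ t) :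
    ∑ m ∈ Finset.range n, poissonProb th m t ≤ 1 := by
  have h : ∑ m ∈ Finset.range n, poissonProb th m t =
      Real.exp (-(th * t)) * ∑ m ∈ Finset.range n, (th * t) ^ m / m.factorial := by
    rw [Finset.mul_sum]
    exact Finset.sum_congr rfl fun m _ => by rw [poissonProb, mul_div_assoc]
  rw [h]
  calc _ ≤ Real.exp (-(th * t)) * Real.exp (th * t) := by
        gcongr
        exact Real.sum_le_exp_of_nonneg (by positivity) n
    _ = 1 := by rw [← Real.exp_add, neg_add_cancel, Real.exp_zero]

lemma poissonProb_le_one (th : ℝ≥0) (m : ℕ) {t : ℝ} (ht : 0 ≤ t) : poissonProb th m t ≤ 1 :=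
  (Finset.single_le_sum (f := fun m => poissonProb th m t)
    (fun i _ => poissonProb_nonneg th i ht) (Finset.self_mem_range_succ m)).trans
    (sum_poissonProb_le th (m + 1) ht)

/-- Poisson laws convolve, by the binomial theorem. This splits the number of points at the first
jump of the queue. -/
lemma poissonProb_add (th : ℝ≥0) (m : ℕ) (s t : ℝ) :
    poissonProb th m (s + t) =
      ∑ p ∈ Finset.HasAntidiagonal.antidiagonal m, poissonProb th p.1 s * poissonProb th p.2 t := by
  rw [poissonProb, mul_add, (Commute.all _ _).add_pow', neg_add, Real.exp_add, Finset.mul_sum,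
    Finset.sum_div]
  refine Finset.sum_congr rfl fun p hp => ?_
  rw [Finset.HasAntidiagonal.mem_antidiagonal] at hp
  subst hp
  rw [poissonProb, poissonProb, nsmul_eq_mul, Nat.choose_symm_add, Nat.add_choose,
    Nat.cast_div (Nat.factorial_mul_factorial_dvd_factorial_add _ _) (by positivity)]
  push_cast
  field_simp

lemma poissonProb_zero_right (th : ℝ≥0) (m : ℕ) : poissonProb th m 0 = if m = 0 then 1 else 0 := by
  by_cases h : m = 0 <;> simp [poissonProb, h]

section

variable {S : Type} [Countable S] [MeasurableSpace S] [MeasurableSingletonClass S]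

lemma integral_chainLaw (q : S → S → ℝ≥0) (x : S) {Z : (ℕ → S × ℝ) → ℂ}
    (hZ : Integrable Z (chainLaw q x)) :
    ∫ ω, Z ω ∂chainLaw q x =
      ∫ s, ∫ ω, Z (consSeq (x, s) ω) ∂nextLaw q x ∂expMeasure (holdRate q x) := by
  have hm := measurable_consSeq_pair x
  rw [chainLaw_eq_consLaw, consLaw] at hZ ⊢
  rw [integral_map hm.aemeasurable hZ.1]
  exact integral_prod _ ((integrable_map_measure hZ.1 hm.aemeasurable).1 hZ)

end

lemma holdRate_poissonRate {th : ℝ≥0} (hth : 0 < th) (a : ℕ) : holdRate (poissonRate th) a = th := by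
  rw [(poissonRate_hasJumps th a).holdRate_eq (by simpa using hth)]
  simp

lemma nextLaw_poissonRate {th : ℝ≥0} (hth : 0 < th) (a : ℕ) :
    nextLaw (poissonRate th) a = chainLaw (poissonRate th) (a + 1) := by
  have h : jumpKernel (poissonRate th) a = Measure.dirac (a + 1) := by
    rw [(poissonRate_hasJumps th a).jumpKernel_eq (by simpa using hth)]
    simp [div_self hth.ne']
  rw [nextLaw, h, Measure.dirac_bind (measurable_chainLaw _)]

lemma ae_le_poisson {th : ℝ≥0} (hth : 0 < th) (a n : ℕ) :
    ∀ᵐ ω ∂chainLaw (poissonRate th) a, a ≤ (ω n).1 := by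
  have hm : ∀ a n : ℕ, MeasurableSet {ω : ℕ → ℕ × ℝ | a ≤ (ω n).1} := fun a n =>
    measurableSet_le measurable_const (by fun_prop)
  induction n generalizing a with
  | zero =>
    filter_upwards [ae_chainLaw_start (poissonRate th) a] with ω hω using hω.ge
  | succ n ih =>
    refine ae_chainLaw _ a (hm a (n + 1)) (Eventually.of_forall fun s => ?_)
    have h : jumpKernel (poissonRate th) a = Measure.dirac (a + 1) := by
      rw [(poissonRate_hasJumps th a).jumpKernel_eq (by simpa using hth)]
      simp [div_self hth.ne']
    rw [h, ae_dirac_eq, eventually_pure]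
    filter_upwards [ih (a + 1)] with ω hω
    simp only [consSeq_succ]
    omega

lemma integral_path_poisson_of_lt {th : ℝ≥0} (hth : 0 < th) {a b : ℕ} (hab : b < a) (t : ℝ) :
    ∫ ω, (if path ω t = b then 1 else 0 : ℂ) ∂chainLaw (poissonRate th) a = 0 := by
  refine (integral_congr_ae (g := fun _ => 0) ?_).trans (integral_zero _ _)
  filter_upwards [ae_all_iff.2 (ae_le_poisson hth a)] with ω hω
  refine if_neg fun h => ?_
  have := hω (sInf {n : ℕ | t < jumpTime ω (n + 1)})
  rw [path] at h
  omega

lemma measurable_ite_path {S : Type} [Countable S] [MeasurableSpace S] [MeasurableSingletonClass S]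
    [DecidableEq S] (b : S) :
    Measurable fun p : (ℕ → S × ℝ) × ℝ => (if path p.1 p.2 = b then 1 else 0 : ℂ) :=
  measurable_comp_path fun y => (if y = b then 1 else 0 : ℂ)

lemma integral_path_poisson_eq {th : ℝ≥0} (hth : 0 < th) (a b : ℕ) (t : ℝ) :
    ∫ ω, (if path ω t = b then 1 else 0 : ℂ) ∂chainLaw (poissonRate th) a =
      ∫ s in Set.Ioi (0 : ℝ), (th * Real.exp (-(th * s)) : ℝ) *
        (if t < s then if a = b then 1 else 0
        else ∫ ω, (if path ω (t - s) = b then 1 else 0 : ℂ)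
          ∂chainLaw (poissonRate th) (a + 1)) := by
  have hm : Measurable fun ω : ℕ → ℕ × ℝ => (if path ω t = b then 1 else 0 : ℂ) :=
    (measurable_ite_path b).comp (f := fun ω : ℕ → ℕ × ℝ => (ω, t)) (by fun_prop)
  have hi : Integrable (fun ω : ℕ → ℕ × ℝ => (if path ω t = b then 1 else 0 : ℂ))
      (chainLaw (poissonRate th) a) :=
    Integrable.of_bound hm.aestronglyMeasurable 1 (Eventually.of_forall fun ω => by
      split_ifs <;> simp)
  rw [integral_chainLaw _ _ hi, nextLaw_poissonRate hth, holdRate_poissonRate hth,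
    integral_expMeasure (by exact_mod_cast hth)]
  refine integral_congr_ae (Eventually.of_forall fun s => ?_)
  simp only
  congr 1
  have h1 : (fun ω : ℕ → ℕ × ℝ => (if path (consSeq (a, s) ω) t = b then 1 else 0 : ℂ))
      =ᵐ[chainLaw (poissonRate th) (a + 1)]
        fun ω => if t < s then if a = b then 1 else 0 else if path ω (t - s) = b then 1 else 0 := by
    filter_upwards [(poissonRate_bounded hth).ae_regular (a + 1)] with ω hω
    rw [path_consSeq hω]
    split_ifs <;> simp_all
  rw [integral_congr_ae h1]
  split_ifs <;> simp

/-- The law of the Poisson process at time `t`. -/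
lemma integral_path_poisson {th : ℝ≥0} (hth : 0 < th) (a m : ℕ) {t : ℝ} (ht : 0 ≤ t) :
    ∫ ω, (if path ω t = a + m then 1 else 0 : ℂ) ∂chainLaw (poissonRate th) a =
      poissonProb th m t := by
  have hth' : (0 : ℝ) < th := by exact_mod_cast hth
  induction m generalizing a t with
  | zero =>
    rw [integral_path_poisson_eq hth]
    -- After its first jump the process exceeds `a` for good, so only `s > t` contributes and an
    -- exponential tail remains.
    have h1 : ∀ s : ℝ, ((th * Real.exp (-(th * s)) : ℝ) : ℂ) *
        (if t < s then if a = a + 0 then 1 else 0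
        else ∫ ω, (if path ω (t - s) = a + 0 then 1 else 0 : ℂ)
          ∂chainLaw (poissonRate th) (a + 1)) =
        Set.indicator (Set.Ioi t) (fun s : ℝ => ((th * Real.exp (-th * s) : ℝ) : ℂ)) s := by
      intro s
      rw [integral_path_poisson_of_lt hth (by omega)]
      by_cases h : t < s
      · rw [Set.indicator_of_mem (by simpa using h)]
        simp [h]
      · rw [Set.indicator_of_notMem (by simpa using h)]
        simp [h]
    simp only [h1]
    rw [setIntegral_indicator measurableSet_Ioi, Set.inter_eq_right.2 (Set.Ioi_subset_Ioi ht),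
      integral_complex_ofReal, integral_const_mul, integral_exp_mul_Ioi (by linarith)]
    have hthC : ((th : ℝ) : ℂ) ≠ 0 := by exact_mod_cast hth.ne'
    simp [poissonProb]
    field_simp
  | succ m ih =>
    rw [integral_path_poisson_eq hth]
    -- Now only `s ≤ t` contributes. The exponentials of `s` and `t - s` combine to a constant, so
    -- the integrand is a multiple of `(t - s) ^ m`.
    have h1 : ∀ s ∈ Set.Ioi (0 : ℝ), ((th * Real.exp (-(th * s)) : ℝ) : ℂ) *
        (if t < s then if a = a + (m + 1) then 1 else 0
        else ∫ ω, (if path ω (t - s) = a + (m + 1) then 1 else 0 : ℂ)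
          ∂chainLaw (poissonRate th) (a + 1)) =
        Set.indicator (Set.Iic t) (fun s : ℝ =>
          ((th * Real.exp (-(th * t)) * th ^ m / m.factorial * (t - s) ^ m : ℝ) : ℂ)) s := by
      intro s hs
      by_cases h : t < s
      · rw [Set.indicator_of_notMem (by simpa using h)]
        simp [h]
      · rw [Set.indicator_of_mem (by simpa using h), if_neg h]
        have h2 : a + (m + 1) = a + 1 + m := by ring
        rw [h2, ih (a + 1) (by linarith : (0 : ℝ) ≤ t - s), ← Complex.ofReal_mul, poissonProb]
        congr 1
        have h3 : Real.exp (-(th * t)) = Real.exp (-(th * s)) * Real.exp (-(th * (t - s))) := by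
          rw [← Real.exp_add]
          ring_nf
        rw [h3, mul_pow]
        ring
    rw [setIntegral_congr_fun measurableSet_Ioi h1, setIntegral_indicator measurableSet_Iic,
      Set.Ioi_inter_Iic, integral_complex_ofReal, integral_const_mul,
      ← intervalIntegral.integral_of_le ht, intervalIntegral.integral_comp_sub_left (fun u => u ^ m) t,
      integral_pow, poissonProb, Nat.factorial_succ]
    simp
    field_simp
    ring

/-! ### Moments of exponentials -/

/-- Half of the exponential decay absorbs the power, through `u ^ m / m! ≤ exp u` at `u = β.re / 2 *
s`. -/
lemma norm_pow_mul_exp_le {β : ℂ} (hβ : 0 < β.re) (m : ℕ) {s : ℝ} (hs : 0 ≤ s) :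
    ‖(s : ℂ) ^ m / m.factorial * Complex.exp (-β * s)‖ ≤
      (2 / β.re) ^ m * Real.exp (-(β.re / 2) * s) := by
  have h1 : (β.re / 2 * s) ^ m / m.factorial ≤ Real.exp (β.re / 2 * s) :=
    Real.pow_div_factorial_le_exp _ (by positivity) m
  rw [norm_mul, norm_exp_neg_mul, norm_div, norm_pow, Complex.norm_real, Real.norm_of_nonneg hs,
    Complex.norm_natCast]
  calc s ^ m / m.factorial * Real.exp (-β.re * s)
      = (2 / β.re) ^ m * ((β.re / 2 * s) ^ m / m.factorial) * Real.exp (-β.re * s) := by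
        rw [← mul_div_assoc, ← mul_pow]
        congr 3
        field_simp
    _ ≤ (2 / β.re) ^ m * Real.exp (β.re / 2 * s) * Real.exp (-β.re * s) := by gcongr
    _ = _ := by
        rw [mul_assoc, ← Real.exp_add]
        ring_nf

lemma integrableOn_pow_mul_exp {β : ℂ} (hβ : 0 < β.re) (m : ℕ) :
    IntegrableOn (fun s : ℝ => (s : ℂ) ^ m / m.factorial * Complex.exp (-β * s)) (Set.Ioi 0) := by
  have hneg : -(β.re / 2) < 0 := by linarith
  refine Integrable.mono' ((integrableOn_exp_mul_Ioi hneg 0).const_mul ((2 / β.re) ^ m))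
    (Continuous.aestronglyMeasurable (by fun_prop)) ?_
  filter_upwards [ae_restrict_mem measurableSet_Ioi] with s hs
  exact norm_pow_mul_exp_le hβ m (le_of_lt hs)

/-- Integration by parts: the left-hand integrand without the factor `β` vanishes at 0 and at
infinity, so its derivative integrates to 0. -/
lemma integral_pow_mul_exp_succ {β : ℂ} (hβ : 0 < β.re) (m : ℕ) :
    β * ∫ s in Set.Ioi (0 : ℝ), (s : ℂ) ^ (m + 1) / (m + 1).factorial * Complex.exp (-β * s) =
      ∫ s in Set.Ioi (0 : ℝ), (s : ℂ) ^ m / m.factorial * Complex.exp (-β * s) := by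
  have h1 := integrableOn_pow_mul_exp hβ m
  have h2 := integrableOn_pow_mul_exp hβ (m + 1)
  have hd : ∀ s : ℝ, HasDerivAt
      (fun s : ℝ => (s : ℂ) ^ (m + 1) / (m + 1).factorial * Complex.exp (-β * s))
      ((s : ℂ) ^ m / m.factorial * Complex.exp (-β * s) -
        β * ((s : ℂ) ^ (m + 1) / (m + 1).factorial * Complex.exp (-β * s))) s := by
    intro s
    have hp := (((hasDerivAt_id (s : ℂ)).pow (m + 1)).div_const ((m + 1).factorial : ℂ)).mul
      (((hasDerivAt_id (s : ℂ)).const_mul (-β)).cexp)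
    have hp' := hp.comp_ofReal
    refine HasDerivAt.congr_deriv (hp'.congr_of_eventuallyEq (Eventually.of_forall fun _ => ?_)) ?_
    · simp
    · simp only [id, Nat.factorial_succ]
      push_cast
      have : (m : ℂ) + 1 ≠ 0 := by exact_mod_cast m.succ_ne_zero
      have : (m.factorial : ℂ) ≠ 0 := by exact_mod_cast m.factorial_ne_zero
      simp
      field_simp
      ring
  have ht : Tendsto (fun s : ℝ => (s : ℂ) ^ (m + 1) / (m + 1).factorial * Complex.exp (-β * s))
      atTop (𝓝 0) := by
    refine squeeze_zero_norm' (a := fun s : ℝ => (2 / β.re) ^ (m + 1) *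
      Real.exp (-(β.re / 2) * s)) ?_ ?_
    · filter_upwards [eventually_ge_atTop 0] with s hs using norm_pow_mul_exp_le hβ (m + 1) hs
    · rw [← mul_zero ((2 / β.re) ^ (m + 1))]
      refine Tendsto.const_mul _ (Real.tendsto_exp_atBot.comp ?_)
      exact tendsto_id.const_mul_atTop_of_neg (by linarith)
  have h3 := integral_Ioi_of_hasDerivAt_of_tendsto' (a := 0) (fun s _ => hd s)
    (h1.sub (h2.const_mul β)) ht
  rw [integral_sub h1 (h2.const_mul β), integral_const_mul] at h3
  simp only [Complex.ofReal_zero, ne_eq, Nat.add_eq_zero_iff, one_ne_zero, and_false,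
    not_false_eq_true, zero_pow, zero_div, zero_mul, sub_zero] at h3
  linear_combination -h3

/-! ### The busy period together with an independent Poisson process -/

/-- The discount factor at time `τ` on the event that a Poisson process has `m` points up to `τ`. -/
def busyWeight (α : ℂ) (th : ℝ≥0) (m : ℕ) (τ : ℝ≥0∞) : ℂ :=
  discount α τ * poissonProb th m τ.toReal

lemma measurable_busyWeight (α : ℂ) (th : ℝ≥0) (m : ℕ) : Measurable (busyWeight α th m) := by
  refine (measurable_discount α).mul (Complex.measurable_ofReal.comp ?_)
  exact (continuous_poissonProb th m).measurable.comp ENNReal.measurable_toReal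

lemma norm_busyWeight_le {α : ℂ} (hα : 0 ≤ α.re) (th : ℝ≥0) (m : ℕ) (τ : ℝ≥0∞) :
    ‖busyWeight α th m τ‖ ≤ poissonProb th m τ.toReal := by
  have h := poissonProb_nonneg th m (ENNReal.toReal_nonneg (a := τ))
  rw [busyWeight, norm_mul, Complex.norm_real, Real.norm_of_nonneg h]
  exact mul_le_of_le_one_left h (norm_discount_le hα τ)

lemma norm_busyWeight_le_one {α : ℂ} (hα : 0 ≤ α.re) (th : ℝ≥0) (m : ℕ) (τ : ℝ≥0∞) :
    ‖busyWeight α th m τ‖ ≤ 1 :=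
  (norm_busyWeight_le hα th m τ).trans (poissonProb_le_one th m ENNReal.toReal_nonneg)

lemma busyWeight_zero (α : ℂ) (th : ℝ≥0) (m : ℕ) :
    busyWeight α th m 0 = if m = 0 then 1 else 0 := by
  rw [busyWeight, discount_zero, ENNReal.toReal_zero, poissonProb_zero_right]
  split_ifs <;> simp

/-- Discount factors multiply over successive time intervals and Poisson counts convolve. For `τ =
∞` both sides vanish. -/
lemma busyWeight_add (α : ℂ) (th : ℝ≥0) (m : ℕ) {s : ℝ} (hs : 0 ≤ s) (τ : ℝ≥0∞) :
    busyWeight α th m (ENNReal.ofReal s + τ) =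
      ∑ p ∈ Finset.HasAntidiagonal.antidiagonal m,
        busyWeight α th p.1 (ENNReal.ofReal s) * busyWeight α th p.2 τ := by
  by_cases h : τ = ⊤
  · simp [busyWeight, h, discount_top]
  · have h0 := discount_add α hs 0
    rw [add_zero, discount_zero, mul_one] at h0
    simp only [busyWeight, discount_add α hs, h0, ENNReal.toReal_add ENNReal.ofReal_ne_top h,
      poissonProb_add, ENNReal.toReal_ofReal hs]
    push_cast
    rw [Finset.mul_sum]
    exact Finset.sum_congr rfl fun p _ => by ring

lemma integrable_busyWeight_ofReal {α : ℂ} (hα : 0 ≤ α.re) (th : ℝ≥0) (m : ℕ) (r : ℝ)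
    [IsProbabilityMeasure (expMeasure r)] :
    Integrable (fun s => busyWeight α th m (ENNReal.ofReal s)) (expMeasure r) :=
  Integrable.of_bound ((measurable_busyWeight α th m).comp
    ENNReal.measurable_ofReal).aestronglyMeasurable 1
    (Eventually.of_forall fun _ => norm_busyWeight_le_one hα th m _)

lemma integral_busyWeight_ofReal {α : ℂ} (th : ℝ≥0) (m : ℕ) {r : ℝ} (hr : 0 < r) :
    ∫ s, busyWeight α th m (ENNReal.ofReal s) ∂expMeasure r =
      r * th ^ m * ∫ s in Set.Ioi (0 : ℝ),
        (s : ℂ) ^ m / m.factorial * Complex.exp (-(α + th + r) * s) := by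
  rw [integral_expMeasure hr, ← integral_const_mul]
  refine setIntegral_congr_fun measurableSet_Ioi fun s hs => ?_
  have hs' : 0 ≤ s := le_of_lt hs
  have h0 := discount_add α hs' 0
  rw [add_zero, discount_zero, mul_one] at h0
  have h1 : Complex.exp (-(α + th + r) * s) =
      Complex.exp (-α * s) * Complex.exp (-(th * s)) * Complex.exp (-(r * s)) := by
    rw [← Complex.exp_add, ← Complex.exp_add]
    ring_nf
  rw [busyWeight, h0, ENNReal.toReal_ofReal hs', poissonProb, h1]
  push_cast
  ring

lemma integral_busyWeight_ofReal_zero {α : ℂ} (hα : 0 ≤ α.re) (th : ℝ≥0) {r : ℝ} (hr : 0 < r) :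
    (α + th + r) * ∫ s, busyWeight α th 0 (ENNReal.ofReal s) ∂expMeasure r = r := by
  have hβ : 0 < (α + th + r).re := by
    simp only [Complex.add_re, Complex.ofReal_re]
    have := th.coe_nonneg
    linarith
  have hβ0 : α + th + r ≠ 0 := fun h => by simp [h] at hβ
  rw [integral_busyWeight_ofReal th 0 hr]
  have h1 := integral_exp_mul_complex_Ioi (a := -(α + th + r)) (by rw [Complex.neg_re]; linarith) 0
  simp only [pow_zero, Nat.factorial_zero, Nat.cast_one, div_one, one_mul, mul_one]
  rw [h1, Complex.ofReal_zero, mul_zero, Complex.exp_zero, neg_div_neg_eq]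
  field_simp

/-- With the case `m = 0` this encodes the value `r θ^m / (α + θ + r)^(m + 1)`. The recursive form
is what turns the convolution over the first sojourn into a backward equation. -/
lemma integral_busyWeight_ofReal_succ {α : ℂ} (hα : 0 ≤ α.re) (th : ℝ≥0) (m : ℕ) {r : ℝ}
    (hr : 0 < r) :
    (α + th + r) * ∫ s, busyWeight α th (m + 1) (ENNReal.ofReal s) ∂expMeasure r =
      th * ∫ s, busyWeight α th m (ENNReal.ofReal s) ∂expMeasure r := by
  have hβ : 0 < (α + th + r).re := by
    simp only [Complex.add_re, Complex.ofReal_re]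
    have := th.coe_nonneg
    linarith
  rw [integral_busyWeight_ofReal th _ hr, integral_busyWeight_ofReal th _ hr,
    ← integral_pow_mul_exp_succ hβ m]
  ring

/-- `E_n[exp (-α B) 1{Λ(B) = m}]`, where `B` is the time until the queue, started with `n`
customers, is empty. -/
def busyCoef (lam mu th : ℝ≥0) (α : ℂ) (n m : ℕ) : ℂ :=
  if n = 0 then if m = 0 then 1 else 0
  else ∫ ω, busyWeight α th m (jumpHit {0} ω) ∂chainLaw (mm1Rate lam mu) n

lemma integrable_busyWeight_jumpHit {α : ℂ} (hα : 0 ≤ α.re) (th : ℝ≥0) (m : ℕ)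
    (P : Measure (ℕ → ℕ × ℝ)) [IsProbabilityMeasure P] :
    Integrable (fun ω => busyWeight α th m (jumpHit {0} ω)) P :=
  Integrable.of_bound ((measurable_busyWeight α th m).comp
    (measurable_jumpHit {0})).aestronglyMeasurable 1
    (Eventually.of_forall fun _ => norm_busyWeight_le_one hα th m _)

/-- At each time the Poisson probabilities sum to at most 1 and the discount has norm at most 1. The
absolute convergence of the matrix series comes from here. -/
lemma sum_norm_busyCoef_le (lam mu th : ℝ≥0) {α : ℂ} (hα : 0 ≤ α.re) (n k : ℕ) :
    ∑ m ∈ Finset.range k, ‖busyCoef lam mu th α n m‖ ≤ 1 := by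
  by_cases hn : n = 0
  · simp only [busyCoef, hn, if_true, apply_ite norm, norm_one, norm_zero, Finset.sum_ite_eq']
    split_ifs <;> simp
  · have hi : ∀ m, Integrable (fun ω => ‖busyWeight α th m (jumpHit {0} ω)‖)
        (chainLaw (mm1Rate lam mu) n) := fun m => (integrable_busyWeight_jumpHit hα th m _).norm
    calc _ ≤ ∑ m ∈ Finset.range k,
          ∫ ω, ‖busyWeight α th m (jumpHit {0} ω)‖ ∂chainLaw (mm1Rate lam mu) n := by
          refine Finset.sum_le_sum fun m _ => ?_
          rw [busyCoef, if_neg hn]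
          exact norm_integral_le_integral_norm _
      _ = ∫ ω, ∑ m ∈ Finset.range k, ‖busyWeight α th m (jumpHit {0} ω)‖
            ∂chainLaw (mm1Rate lam mu) n := (integral_finsetSum _ fun m _ => hi m).symm
      _ ≤ ∫ _, (1 : ℝ) ∂chainLaw (mm1Rate lam mu) n := by
          refine integral_mono (integrable_finsetSum _ fun m _ => hi m) (integrable_const _)
            fun ω => ?_
          exact (Finset.sum_le_sum fun m _ => norm_busyWeight_le hα th m _).trans
            (sum_poissonProb_le th k ENNReal.toReal_nonneg)
      _ = 1 := by simp

/-- Conditioning on the first jump of the queue. -/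
lemma busyCoef_eq_sum {lam : ℝ≥0} (hlam : 0 < lam) (mu th : ℝ≥0) {α : ℂ} (hα : 0 ≤ α.re) (n m : ℕ) :
    busyCoef lam mu th α (n + 1) m = ∑ p ∈ Finset.HasAntidiagonal.antidiagonal m,
      (∫ s, busyWeight α th p.1 (ENNReal.ofReal s) ∂expMeasure (holdRate (mm1Rate lam mu) (n + 1))) *
        ∫ y, busyCoef lam mu th α y p.2 ∂jumpKernel (mm1Rate lam mu) (n + 1) := by
  classical
  let V : ℕ → (ℕ → ℕ × ℝ) → ℂ := fun m ω =>
    busyWeight α th m (if (ω 0).1 ∈ ({0} : Set ℕ) then 0 else jumpHit {0} ω)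
  have hV : ∀ m, Measurable (V m) := fun m => by
    refine (measurable_busyWeight α th m).comp (Measurable.ite ?_ measurable_const
      (measurable_jumpHit {0}))
    exact (measurableSet_singleton 0).preimage (measurable_fst.comp (measurable_pi_apply _))
  have h := (mm1Rate_bounded (mu := mu) hlam).integral_eq_sum (n + 1)
    (Finset.HasAntidiagonal.antidiagonal m)
    (Z := fun ω => busyWeight α th m (jumpHit {0} ω))
    (b := fun p s => busyWeight α th p.1 (ENNReal.ofReal s)) (V := fun p => V p.2)
    ((measurable_busyWeight α th m).comp (measurable_jumpHit {0})).aestronglyMeasurable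
    (fun p _ => integrable_busyWeight_ofReal hα th p.1 _)
    (fun p _ => Integrable.of_bound (hV p.2).aestronglyMeasurable 1
      (Eventually.of_forall fun _ => norm_busyWeight_le_one hα th _ _))
    (fun s ω hs hω => by
      simp only [V]
      rw [jumpHit_consSeq {0} (a := (n + 1, s)) hω hs.le, busyWeight_add α th m hs.le]
      congr!)
  rw [busyCoef, if_neg n.succ_ne_zero, h]
  refine Finset.sum_congr rfl fun p _ => ?_
  congr 1
  refine integral_congr_ae (Eventually.of_forall fun y => ?_)
  simp only
  have h3 : V p.2 =ᵐ[chainLaw (mm1Rate lam mu) y] fun ω =>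
      if y = 0 then if p.2 = 0 then 1 else 0 else busyWeight α th p.2 (jumpHit {0} ω) := by
    filter_upwards [ae_chainLaw_start (mm1Rate lam mu) y] with ω hω
    simp only [V, hω, Set.mem_singleton_iff]
    by_cases hy : y = 0
    · rw [if_pos hy, if_pos hy, busyWeight_zero]
    · rw [if_neg hy, if_neg hy]
  rw [integral_congr_ae h3, busyCoef]
  split_ifs <;> simp

/-- The backward equations. -/
lemma busyCoef_rec {lam : ℝ≥0} (hlam : 0 < lam) (mu th : ℝ≥0) {α : ℂ} (hα : 0 ≤ α.re) (n m : ℕ) :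
    (α + th + lam + mu) * busyCoef lam mu th α (n + 1) m =
      lam * busyCoef lam mu th α (n + 2) m + mu * busyCoef lam mu th α n m +
        if m = 0 then 0 else th * busyCoef lam mu th α (n + 1) (m - 1) := by
  have hJ := mm1Rate_hasJumps lam mu (n + 1)
  have hw : 0 < ∑ i, (![lam, if n + 1 = 0 then 0 else mu] : Fin 2 → ℝ≥0) i := by
    simp only [Fin.sum_univ_two, Matrix.cons_val_zero, Matrix.cons_val_one]
    exact add_pos_of_pos_of_nonneg hlam zero_le
  have hr : holdRate (mm1Rate lam mu) (n + 1) = lam + mu := by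
    rw [hJ.holdRate_eq hw]
    simp
  have hr0 : 0 < holdRate (mm1Rate lam mu) (n + 1) := holdRate_pos _ _
  have hP : ∀ k, (holdRate (mm1Rate lam mu) (n + 1) : ℂ) *
      ∫ y, busyCoef lam mu th α y k ∂jumpKernel (mm1Rate lam mu) (n + 1) =
        lam * busyCoef lam mu th α (n + 2) k + mu * busyCoef lam mu th α n k := fun k => by
    rw [hJ.integral_eq hw]
    simp
  have hβ : α + th + lam + mu = α + th + (holdRate (mm1Rate lam mu) (n + 1) : ℝ) := by
    rw [hr]
    push_cast
    ring
  rw [hβ, ← hP m]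
  cases m with
  | zero =>
    rw [busyCoef_eq_sum hlam mu th hα n 0, Finset.Nat.antidiagonal_zero, Finset.sum_singleton,
      ← mul_assoc, integral_busyWeight_ofReal_zero hα th hr0]
    simp
  | succ m =>
    -- The term with no point during the first sojourn yields the two queue jumps. In the others one
    -- point is removed from the first sojourn, which reassembles `θ` times the coefficient with
    -- index `m`.
    rw [if_neg m.succ_ne_zero, Nat.add_sub_cancel, busyCoef_eq_sum hlam mu th hα n (m + 1),
      Finset.Nat.sum_antidiagonal_succ, mul_add, ← mul_assoc,
      integral_busyWeight_ofReal_zero hα th hr0, busyCoef_eq_sum hlam mu th hα n m, Finset.mul_sum,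
      Finset.mul_sum]
    congr 1
    refine Finset.sum_congr rfl fun p _ => ?_
    rw [← mul_assoc, integral_busyWeight_ofReal_succ hα th p.1 hr0, mul_assoc]

/-- By independence and Fubini the Poisson process can be integrated out first, with the length of
the busy period held fixed. -/
lemma busyPoisson_eq {lam : ℝ≥0} (hlam : 0 < lam) (mu : ℝ≥0) {th : ℝ≥0} (hth : 0 < th) {α : ℂ}
    (hα : 0 ≤ α.re) (m : ℕ) : busyPoisson lam mu th m α = busyCoef lam mu th α 1 m := by
  classical
  let F : (ℕ → ℕ × ℝ) × (ℕ → ℕ × ℝ) → ℂ := fun ω =>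
    discount α (jumpHit {0} ω.1) *
      (if path ω.2 (jumpHit {0} ω.1).toReal = m then 1 else 0)
  have hF : Measurable F := by
    refine ((measurable_discount α).comp ((measurable_jumpHit {0}).comp measurable_fst)).mul ?_
    exact (measurable_ite_path m).comp
      (f := fun ω : (ℕ → ℕ × ℝ) × (ℕ → ℕ × ℝ) => (ω.2, (jumpHit {0} ω.1).toReal))
      (measurable_snd.prodMk ((measurable_jumpHit {0}).comp measurable_fst).ennreal_toReal)
  have hFi : Integrable F ((chainLaw (mm1Rate lam mu) 1).prod (chainLaw (poissonRate th) 0)) := by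
    refine Integrable.of_bound hF.aestronglyMeasurable 1 (Eventually.of_forall fun ω => ?_)
    simp only [F]
    rw [norm_mul]
    refine mul_le_one₀ (norm_discount_le hα _) (norm_nonneg _) ?_
    split_ifs <;> simp
  have h1 : (fun ω : (ℕ → ℕ × ℝ) × (ℕ → ℕ × ℝ) => discount α (hitTime (path ω.1) {0}) *
      (if path ω.2 (hitTime (path ω.1) {0}).toReal = m then 1 else 0))
        =ᵐ[(chainLaw (mm1Rate lam mu) 1).prod (chainLaw (poissonRate th) 0)] F := by
    have h2 : ∀ᵐ ω ∂(chainLaw (mm1Rate lam mu) 1).prod (chainLaw (poissonRate th) 0),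
        Regular ω.1 :=
      Measure.quasiMeasurePreserving_fst.ae ((mm1Rate_bounded hlam).ae_regular 1)
    filter_upwards [h2] with ω hω
    rw [hω.hitTime_eq]
  rw [busyCoef, if_neg one_ne_zero, busyPoisson]
  refine Eq.trans ?_ ((integral_congr_ae h1).trans ((integral_prod F hFi).trans ?_))
  · congr!
  · refine integral_congr_ae (Eventually.of_forall fun ω => ?_)
    simp only [F]
    have h3 := integral_path_poisson hth 0 m (ENNReal.toReal_nonneg (a := jumpHit {0} ω))
    rw [zero_add] at h3
    rw [integral_const_mul, busyWeight, ← h3]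

/-! ### The resolvent of the bounded generator of the priority queue -/

/-- The indicator function of a state. -/
def stateInd {S : Type} [DecidableEq S] (y x : S) : ℂ := if x = y then 1 else 0

lemma norm_stateInd_le {S : Type} [DecidableEq S] (y x : S) : ‖stateInd y x‖ ≤ 1 := by
  unfold stateInd
  split_ifs <;> simp

/-- The expected reward up to an infinite horizon is the Laplace transform of the transition
function. -/
lemma integral_transition {S : Type} [Countable S] [MeasurableSpace S]
    [MeasurableSingletonClass S] [DecidableEq S] (q : S → S → ℝ≥0) {α : ℂ} (hα : 0 < α.re)
    (x y : S) :
    ∫ t in Set.Ici (0 : ℝ), Complex.exp (-α * t) * ((chainLaw q x).real {ω | path ω t = y} : ℂ) =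
      meanTotal q α ∅ (stateInd y) 0 x := by
  have hf : Measurable fun p : ℝ × (ℕ → S × ℝ) =>
      Complex.exp (-α * p.1) * stateInd y (path p.2 p.1) := by
    have h1 : Measurable fun p : ℝ × (ℕ → S × ℝ) => Complex.exp (-α * p.1) := by fun_prop
    exact h1.mul ((measurable_comp_path (stateInd y)).comp measurable_swap)
  have hi : Integrable (Function.uncurry fun (t : ℝ) (ω : ℕ → S × ℝ) =>
      Complex.exp (-α * t) * stateInd y (path ω t))
      ((volume.restrict (Set.Ici (0 : ℝ))).prod (chainLaw q x)) := by
    have hg : Integrable (fun p : ℝ × (ℕ → S × ℝ) => Real.exp (-α.re * p.1) * 1)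
        ((volume.restrict (Set.Ici (0 : ℝ))).prod (chainLaw q x)) :=
      Integrable.mul_prod (integrableOn_exp_Ici hα) (integrable_const (1 : ℝ))
    refine hg.mono' hf.aestronglyMeasurable (Eventually.of_forall fun p => ?_)
    simp only [Function.uncurry]
    rw [norm_mul, norm_exp_neg_mul]
    gcongr
    exact norm_stateInd_le _ _
  have h1 : ∀ t : ℝ, ((chainLaw q x).real {ω | path ω t = y} : ℂ) =
      ∫ ω, stateInd y (path ω t) ∂chainLaw q x := by
    intro t
    have hm : MeasurableSet {ω : ℕ → S × ℝ | path ω t = y} :=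
      (measurableSet_singleton y).preimage
        (measurable_path.comp (f := fun ω : ℕ → S × ℝ => (ω, t)) (by fun_prop))
    have h2 : (fun ω : ℕ → S × ℝ => stateInd y (path ω t)) =
        Set.indicator {ω : ℕ → S × ℝ | path ω t = y} fun _ => (1 : ℂ) := by
      funext ω
      by_cases h : path ω t = y
      · rw [Set.indicator_of_mem (by simpa using h), stateInd, if_pos h]
      · rw [Set.indicator_of_notMem (by simpa using h), stateInd, if_neg h]
    rw [h2, integral_indicator hm, setIntegral_const, Complex.real_smul, mul_one]
  simp only [h1]
  simp only [← integral_const_mul]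
  rw [integral_integral_swap hi, meanTotal]
  refine integral_congr_ae (Eventually.of_forall fun ω => ?_)
  -- The empty set is never entered, so the reward runs over the whole half-line and no terminal
  -- payment occurs.
  have h3 : jumpHit (∅ : Set S) ω = ⊤ := by simp [jumpHit]
  have h4 : {t : ℝ | 0 ≤ t ∧ ENNReal.ofReal t < ⊤} = Set.Ici 0 := by
    ext t
    simp
  simp only [total, h3, discount_top, zero_mul, add_zero, reward, h4]

namespace Params

variable (M : Params)

/-- The total transition rate out of `x`. -/
def exit (x : ℕ × ℕ) : ℝ := ∑ i, (M.weight x i : ℝ)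

/-- The off-diagonal part of the generator. -/
def gen (g : ℕ × ℕ → ℂ) (x : ℕ × ℕ) : ℂ := ∑ i, (M.weight x i : ℝ) * g (target x i)

lemma exit_nonneg (x : ℕ × ℕ) : 0 ≤ M.exit x := Finset.sum_nonneg fun _ _ => NNReal.coe_nonneg _

lemma gen_eq (g : ℕ × ℕ → ℂ) (a b : ℕ) : M.gen g (a, b) =
    (M.lam₁ : ℝ) * g (a + 1, b) + (M.lam₂ : ℝ) * g (a, b + 1) +
      (min a (M.c - b) : ℕ) * (M.mu₁ : ℝ) * g (a - 1, b) +
        (min M.c b : ℕ) * (M.mu₂ : ℝ) * g (a, b - 1) := by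
  simp [gen, weight, target, Fin.sum_univ_four, -Nat.cast_min]

lemma exit_eq (a b : ℕ) : M.exit (a, b) =
    M.lam₁ + M.lam₂ + (min a (M.c - b) : ℕ) * M.mu₁ + (min M.c b : ℕ) * M.mu₂ := by
  simp [exit, weight, Fin.sum_univ_four, -Nat.cast_min]

lemma gen_sub (g h : ℕ × ℕ → ℂ) (x : ℕ × ℕ) :
    M.gen (fun y => g y - h y) x = M.gen g x - M.gen h x := by
  simp only [gen, mul_sub, Finset.sum_sub_distrib]

lemma gen_add (g h : ℕ × ℕ → ℂ) (x : ℕ × ℕ) :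
    M.gen (fun y => g y + h y) x = M.gen g x + M.gen h x := by
  simp only [gen, mul_add, Finset.sum_add_distrib]

lemma gen_sum {ι : Type} (I : Finset ι) (a : ι → ℂ) (g : ι → ℕ × ℕ → ℂ) (x : ℕ × ℕ) :
    M.gen (fun y => ∑ i ∈ I, a i * g i y) x = ∑ i ∈ I, a i * M.gen (g i) x := by
  simp only [gen, Finset.mul_sum]
  rw [Finset.sum_comm]
  exact Finset.sum_congr rfl fun i _ => Finset.sum_congr rfl fun j _ => by ring

open Classical in
lemma meanTotal_rate (h : 0 < M.lam₁) {α : ℂ} (hα : 0 < α.re) (A : Set (ℕ × ℕ))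
    {f g : ℕ × ℕ → ℂ} {C D : ℝ} (hC : 0 ≤ C) (hf : ∀ x, ‖f x‖ ≤ C) (hg : ∀ x, ‖g x‖ ≤ D)
    (x : ℕ × ℕ) :
    (α + M.exit x) * meanTotal M.rate α A f g x =
      f x + M.gen (fun y => if y ∈ A then g y else meanTotal M.rate α A f g y) x := by
  have h1 := (M.rate_bounded h).meanTotal_eq hα A hC hf hg x
  rwa [(M.rate_hasJumps x).integral_eq (M.weight_pos h x),
    (M.rate_hasJumps x).holdRate_eq (M.weight_pos h x)] at h1

lemma exit_le (x : ℕ × ℕ) :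
    M.exit x ≤ M.lam₁ + M.lam₂ + M.c * M.mu₁ + M.c * M.mu₂ := by
  obtain ⟨a, b⟩ := x
  rw [exit_eq]
  gcongr
  · exact (min_le_right _ _).trans (Nat.sub_le _ _)
  · exact min_le_left _ _

/-- The maximum principle: a bounded function that solves the resolvent equation wherever it does
not vanish is zero. -/
theorem eq_zero_of_gen {α : ℂ} (hα : 0 < α.re) {g : ℕ × ℕ → ℂ} {C : ℝ} (hg : ∀ x, ‖g x‖ ≤ C)
    (h : ∀ x, g x ≠ 0 → (α + M.exit x) * g x = M.gen g x) (x : ℕ × ℕ) : g x = 0 := by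
  set L : ℝ := M.lam₁ + M.lam₂ + M.c * M.mu₁ + M.c * M.mu₂ with hL
  have hL0 : 0 ≤ L := (M.exit_nonneg 0).trans (M.exit_le 0)
  have hC : 0 ≤ C := (norm_nonneg _).trans (hg 0)
  -- `L` bounds all exit rates and `u ↦ u / (Re α + u)` is increasing, so one application of the
  -- equation shrinks a bound on `g` by the factor `ρ < 1`.
  set ρ : ℝ := L / (α.re + L) with hρ
  have hρ0 : 0 ≤ ρ := by positivity
  have hρ1 : ρ < 1 := by
    rw [hρ, div_lt_one (by linarith)]
    linarith
  have key : ∀ n : ℕ, ∀ x, ‖g x‖ ≤ ρ ^ n * C := by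
    intro n
    induction n with
    | zero => simpa using hg
    | succ n ih =>
      intro x
      -- Zeros of `g` satisfy every bound, so no equation is needed there. This allows `g` to be a
      -- difference of solutions cut off to 0 outside a region.
      by_cases hx : g x = 0
      · rw [hx, norm_zero]
        positivity
      have h0 := M.exit_nonneg x
      have h1 : α.re + M.exit x ≤ ‖α + M.exit x‖ := by
        have := Complex.re_le_norm (α + M.exit x)
        simpa using this
      have h2 : ‖M.gen g x‖ ≤ M.exit x * (ρ ^ n * C) := by
        rw [gen, exit, Finset.sum_mul]
        refine (norm_sum_le _ _).trans (Finset.sum_le_sum fun i _ => ?_)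
        rw [norm_mul, Complex.norm_real, Real.norm_of_nonneg (NNReal.coe_nonneg _)]
        gcongr
        exact ih _
      have h3 : (α.re + M.exit x) * ‖g x‖ ≤ M.exit x * (ρ ^ n * C) := by
        refine le_trans ?_ h2
        rw [← h x hx, norm_mul]
        gcongr
      have h4 : M.exit x ≤ ρ * (α.re + M.exit x) := by
        have := M.exit_le x
        rw [hρ, div_mul_eq_mul_div, le_div_iff₀ (by linarith)]
        nlinarith
      have h5 : 0 ≤ ρ ^ n * C := by positivity
      have h6 : (α.re + M.exit x) * ‖g x‖ ≤ (α.re + M.exit x) * (ρ ^ (n + 1) * C) := by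
        refine h3.trans ((mul_le_mul_of_nonneg_right h4 h5).trans_eq ?_)
        ring
      exact le_of_mul_le_mul_left h6 (by linarith)
  have ht : Tendsto (fun n : ℕ => ρ ^ n * C) atTop (𝓝 0) := by
    simpa using (tendsto_pow_atTop_nhds_zero_of_lt_one hρ0 hρ1).mul_const C
  have := ge_of_tendsto' ht fun n => key n x
  exact norm_le_zero_iff.1 this

lemma laplace_eq {α : ℂ} (hα : 0 < α.re) (x : ℕ × ℕ) :
    M.laplace x α = meanTotal M.rate α ∅ (stateInd x) 0 (0, 0) :=
  integral_transition M.rate hα (0, 0) x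

lemma N_eq (h : 0 < M.lam₁) (i : ℕ) (α : ℂ) (k l : Fin M.c) : M.N i α k l =
    meanTotal M.rate α (M.lowerLevel (i - 1)) (stateInd (i, (l : ℕ))) 0 (i, k) := by
  rw [N, meanTotal, law]
  refine integral_congr_ae ?_
  filter_upwards [(M.rate_bounded h).ae_regular (i, (k : ℕ))] with ω hω
  simp only [total, Pi.zero_apply, mul_zero, add_zero, reward, stateInd, ← hω.hitTime_eq]

lemma G_eq (h : 0 < M.lam₁) {i j : ℕ} (hij : i ≠ j) (α : ℂ) (k l : Fin M.c) : M.G i j α k l =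
    meanTotal M.rate α (M.lowerLevel j) 0 (stateInd (j, (l : ℕ))) (i, k) := by
  refine (congrFun (congrFun (if_neg hij) k) l).trans ?_
  rw [meanTotal, law]
  refine integral_congr_ae ?_
  filter_upwards [(M.rate_bounded h).ae_regular (i, (k : ℕ))] with ω hω
  simp only [total, Pi.zero_apply, mul_zero, reward, integral_zero, zero_add, stateInd,
    ← hω.hitTime_eq]

end Params

/-! ### Functions of the level at the end of an excursion above the servers -/

section BusySum

variable {lam mu th : ℝ≥0} {α : ℂ}

lemma summable_norm_busyCoef (lam mu th : ℝ≥0) {α : ℂ} (hα : 0 ≤ α.re) (n : ℕ) :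
    Summable fun m => ‖busyCoef lam mu th α n m‖ :=
  summable_of_sum_range_le (fun _ => norm_nonneg _) (sum_norm_busyCoef_le lam mu th hα n)

lemma tsum_norm_busyCoef_le (lam mu th : ℝ≥0) {α : ℂ} (hα : 0 ≤ α.re) (n : ℕ) :
    ∑' m, ‖busyCoef lam mu th α n m‖ ≤ 1 :=
  Real.tsum_le_of_sum_range_le (fun _ => norm_nonneg _) (sum_norm_busyCoef_le lam mu th hα n)

/-- The discounted mean of `H` at the level `a + Λ(B)`, where the busy period `B` starts with `k`
customers. -/
def busySum (lam mu th : ℝ≥0) (α : ℂ) (H : ℕ → ℂ) (a k : ℕ) : ℂ :=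
  ∑' m, busyCoef lam mu th α k m * H (a + m)

lemma summable_busySum (lam mu th : ℝ≥0) {α : ℂ} (hα : 0 ≤ α.re) {H : ℕ → ℂ} {C : ℝ}
    (hH : ∀ a, ‖H a‖ ≤ C) (a k : ℕ) :
    Summable fun m => busyCoef lam mu th α k m * H (a + m) := by
  refine Summable.of_norm_bounded ((summable_norm_busyCoef lam mu th hα k).mul_right C)
    fun m => ?_
  rw [norm_mul]
  gcongr
  exact hH _

lemma norm_busySum_le (lam mu th : ℝ≥0) {α : ℂ} (hα : 0 ≤ α.re) {H : ℕ → ℂ} {C : ℝ}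
    (hH : ∀ a, ‖H a‖ ≤ C) (a k : ℕ) : ‖busySum lam mu th α H a k‖ ≤ C := by
  have hC : 0 ≤ C := (norm_nonneg _).trans (hH 0)
  have hs := (summable_norm_busyCoef lam mu th hα k).mul_right C
  calc _ ≤ ∑' m, ‖busyCoef lam mu th α k m‖ * C := by
        refine tsum_of_norm_bounded hs.hasSum fun m => ?_
        rw [norm_mul]
        gcongr
        exact hH _
    _ ≤ C := by
        rw [tsum_mul_right]
        exact mul_le_of_le_one_left hC (tsum_norm_busyCoef_le lam mu th hα k)

lemma busySum_zero (lam mu th : ℝ≥0) (α : ℂ) (H : ℕ → ℂ) (a : ℕ) :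
    busySum lam mu th α H a 0 = H a := by
  rw [busySum, tsum_eq_single 0 fun m hm => by simp [busyCoef, hm]]
  simp [busyCoef]

/-- Sum `busyCoef_rec` against `H (a + m)`. Lowering `m` by one in the Poisson term becomes raising
the level from `a` to `a + 1`. -/
lemma busySum_rec (hlam : 0 < lam) (hα : 0 ≤ α.re) {H : ℕ → ℂ} {C : ℝ} (hH : ∀ a, ‖H a‖ ≤ C)
    (a k : ℕ) :
    (α + th + lam + mu) * busySum lam mu th α H a (k + 1) =
      th * busySum lam mu th α H (a + 1) (k + 1) + lam * busySum lam mu th α H a (k + 2) +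
        mu * busySum lam mu th α H a k := by
  have hs := summable_busySum lam mu th hα hH
  have h1 : ∀ m, (α + th + lam + mu) * (busyCoef lam mu th α (k + 1) m * H (a + m)) =
      lam * (busyCoef lam mu th α (k + 2) m * H (a + m)) +
        mu * (busyCoef lam mu th α k m * H (a + m)) +
          (if m = 0 then 0 else th * busyCoef lam mu th α (k + 1) (m - 1)) * H (a + m) := by
    intro m
    rw [← mul_assoc, busyCoef_rec hlam mu th hα]
    ring
  have h2 : ∀ m, (if m + 1 = 0 then 0 else th * busyCoef lam mu th α (k + 1) (m + 1 - 1)) *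
      H (a + (m + 1)) = th * (busyCoef lam mu th α (k + 1) m * H (a + 1 + m)) := by
    intro m
    rw [if_neg m.succ_ne_zero, Nat.add_sub_cancel, add_comm m 1, add_assoc, mul_assoc]
  have hs3 : Summable fun m =>
      (if m = 0 then 0 else th * busyCoef lam mu th α (k + 1) (m - 1)) * H (a + m) := by
    rw [← summable_nat_add_iff 1]
    simp only [h2]
    exact (hs (a + 1) (k + 1)).mul_left _
  simp only [busySum]
  rw [← tsum_mul_left]
  simp only [h1]
  rw [(((hs a (k + 2)).mul_left _).add ((hs a k).mul_left _)).tsum_add hs3,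
    ((hs a (k + 2)).mul_left _).tsum_add ((hs a k).mul_left _), tsum_mul_left, tsum_mul_left,
    hs3.tsum_eq_zero_add]
  simp only [h2, tsum_mul_left, if_true, zero_mul, zero_add]
  ring

end BusySum

/-! ### Mean functionals of the priority queue and their strong Markov identities. -/

namespace Params

variable (M : Params)

/-- The function `x ↦ E_x[∫_0^τ exp (-α t) 1{X(t) = (i + 1, l)} dt]`, where `τ` is the first time of
a transition into lower level `i`. -/
def levelMean (α : ℂ) (i l : ℕ) (x : ℕ × ℕ) : ℂ :=
  meanTotal M.rate α (M.lowerLevel i) (stateInd (i + 1, l)) 0 x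

/-- The function `x ↦ E_x[exp (-α τ) 1{X(τ) = (j, p)}]`, where `τ` is the first time of a transition
into lower level `j`. -/
def hitMean (α : ℂ) (j p : ℕ) (x : ℕ × ℕ) : ℂ :=
  meanTotal M.rate α (M.lowerLevel j) 0 (stateInd (j, p)) x

/-- The function `x ↦ E_x[∫_0^∞ exp (-α t) 1{X(t) = y} dt]`. -/
def resolvent (α : ℂ) (y x : ℕ × ℕ) : ℂ := meanTotal M.rate α ∅ (stateInd y) 0 x

variable {M} {α : ℂ}

lemma norm_levelMean_le (hα : 0 < α.re) (i l : ℕ) (x : ℕ × ℕ) :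
    ‖M.levelMean α i l x‖ ≤ 1 / α.re := by
  simpa [levelMean] using norm_meanTotal_le M.rate hα (M.lowerLevel i) (g := 0) (D := 0) zero_le_one
    (norm_stateInd_le (i + 1, l)) (by simp) x

lemma norm_hitMean_le (hα : 0 < α.re) (j p : ℕ) (x : ℕ × ℕ) : ‖M.hitMean α j p x‖ ≤ 1 := by
  simpa [hitMean] using norm_meanTotal_le M.rate hα (M.lowerLevel j) (f := 0) (C := 0) le_rfl (by simp)
    (norm_stateInd_le (j, p)) x

lemma norm_resolvent_le (hα : 0 < α.re) (y x : ℕ × ℕ) : ‖M.resolvent α y x‖ ≤ 1 / α.re := by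
  simpa [resolvent] using norm_meanTotal_le M.rate hα ∅ (g := 0) (D := 0) zero_le_one
    (norm_stateInd_le y) (by simp) x

lemma resolvent_eq (h : 0 < M.lam₁) (hα : 0 < α.re) (y x : ℕ × ℕ) :
    (α + M.exit x) * M.resolvent α y x = stateInd y x + M.gen (M.resolvent α y) x := by
  have h1 := M.meanTotal_rate h hα ∅ (g := 0) (D := 0) zero_le_one (norm_stateInd_le y) (by simp) x
  simp only [Set.mem_empty_iff_false, if_false] at h1
  exact h1

open Classical in
lemma levelMean_eq (h : 0 < M.lam₁) (hα : 0 < α.re) (i l : ℕ) (x : ℕ × ℕ) :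
    (α + M.exit x) * M.levelMean α i l x = stateInd (i + 1, l) x +
      M.gen (fun y => if y ∈ M.lowerLevel i then 0 else M.levelMean α i l y) x :=
  M.meanTotal_rate h hα (M.lowerLevel i) (g := 0) (D := 0) zero_le_one
    (norm_stateInd_le (i + 1, l)) (by simp) x

open Classical in
lemma hitMean_eq (h : 0 < M.lam₁) (hα : 0 < α.re) (j p : ℕ) (x : ℕ × ℕ) :
    (α + M.exit x) * M.hitMean α j p x =
      M.gen (fun y => if y ∈ M.lowerLevel j then stateInd (j, p) y else M.hitMean α j p y) x := by
  have h1 := M.meanTotal_rate h hα (M.lowerLevel j) (f := 0) (C := 0) le_rfl (by simp)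
    (norm_stateInd_le (j, p)) x
  rwa [Pi.zero_apply, zero_add] at h1

/-- The generator at a state in which all servers are busy with class-2 customers. -/
lemma gen_of_le (g : ℕ × ℕ → ℂ) {a b : ℕ} (hb : M.c ≤ b) : M.gen g (a, b) =
    M.lam₁ * g (a + 1, b) + M.lam₂ * g (a, b + 1) + (M.c : ℂ) * M.mu₂ * g (a, b - 1) := by
  rw [gen_eq, Nat.sub_eq_zero_of_le hb, Nat.min_zero, min_eq_left hb]
  simp

lemma exit_of_le {a b : ℕ} (hb : M.c ≤ b) :
    M.exit (a, b) = M.lam₁ + M.lam₂ + M.c * M.mu₂ := by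
  rw [exit_eq, Nat.sub_eq_zero_of_le hb, Nat.min_zero, min_eq_left hb]
  simp

/-- The busy-period sum for the priority queue: the state is `(a, c - 1 + k)`. -/
def upperSum (M : Params) (α : ℂ) (H : ℕ → ℂ) (a k : ℕ) : ℂ :=
  busySum M.lam₂ (M.c * M.mu₂) M.lam₁ α H a k

/-- With at least `c` class-2 customers no class-1 customer is served, so the recursion for the
`M/M/1` queue and the Poisson process is the resolvent equation of the priority queue. The shift `b
+ 1 - c` counts the departures needed to reach `c - 1`. -/
lemma upperSum_eq (h : 0 < M.lam₂) (hα : 0 < α.re) {H : ℕ → ℂ} {C : ℝ} (hH : ∀ a, ‖H a‖ ≤ C)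
    {a b : ℕ} (hb : M.c ≤ b) :
    (α + M.exit (a, b)) * M.upperSum α H a (b + 1 - M.c) =
      M.gen (fun y => M.upperSum α H y.1 (y.2 + 1 - M.c)) (a, b) := by
  obtain ⟨k, rfl⟩ := Nat.exists_eq_add_of_le hb
  have h1 := busySum_rec (mu := M.c * M.mu₂) (th := M.lam₁) h hα.le hH a k
  have e1 : M.c + k + 1 - M.c = k + 1 := by omega
  have e2 : M.c + k + 1 + 1 - M.c = k + 2 := by omega
  rw [gen_of_le _ hb, exit_of_le hb]
  simp only [e1, e2, upperSum]
  push_cast at h1 ⊢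
  -- For `c = 0` the service term has coefficient 0, so its index, distorted by truncated
  -- subtraction, is irrelevant.
  rcases Nat.eq_zero_or_pos M.c with hc | hc
  · simp only [hc, Nat.cast_zero, zero_mul] at h1 ⊢
    linear_combination h1
  · have e3 : M.c + k - 1 + 1 - M.c = k := by omega
    rw [e3]
    linear_combination h1

/-- Agreement is asked only where the weight can be nonzero. The condition `b < c` in `h3` expresses
that a level can drop only from a lower state. -/
lemma gen_congr {g h : ℕ × ℕ → ℂ} {a b : ℕ} (h1 : g (a + 1, b) = h (a + 1, b))
    (h2 : g (a, b + 1) = h (a, b + 1)) (h3 : 0 < a → b < M.c → g (a - 1, b) = h (a - 1, b))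
    (h4 : 0 < b → g (a, b - 1) = h (a, b - 1)) : M.gen g (a, b) = M.gen h (a, b) := by
  rw [gen_eq, gen_eq, h1, h2]
  congr 1
  · congr 1
    by_cases h : 0 < a ∧ b < M.c
    · rw [h3 h.1 h.2]
    · have : min a (M.c - b) = 0 := by omega
      simp [this]
  · by_cases h : 0 < b
    · rw [h4 h]
    · have : min M.c b = 0 := by omega
      simp [this]

/-- `levelMean` in the last lower state of each level above `i`. -/
def cornerMean (M : Params) (α : ℂ) (i l a : ℕ) : ℂ :=
  if i < a then M.levelMean α i l (a, M.c - 1) else 0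

lemma norm_cornerMean_le (hα : 0 < α.re) (i l a : ℕ) : ‖M.cornerMean α i l a‖ ≤ 1 / α.re := by
  rw [cornerMean]
  split_ifs
  · exact norm_levelMean_le hα i l _
  · rw [norm_zero]
    positivity

lemma norm_upperSum_le (hα : 0 ≤ α.re) {H : ℕ → ℂ} {C : ℝ} (hH : ∀ a, ‖H a‖ ≤ C) (a k : ℕ) :
    ‖M.upperSum α H a k‖ ≤ C :=
  norm_busySum_le _ _ _ hα hH a k

/-- The strong Markov property at the end of an excursion to the upper states. -/
lemma levelMean_eq_upperSum (hc : 0 < M.c) (h1 : 0 < M.lam₁) (h2 : 0 < M.lam₂) (hα : 0 < α.re)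
    {i l : ℕ} (hl : l < M.c) {a b : ℕ} (ha : i < a) (hb : M.c ≤ b) :
    M.levelMean α i l (a, b) = M.upperSum α (M.cornerMean α i l) a (b + 1 - M.c) := by
  classical
  have hH := norm_cornerMean_le (M := M) hα i l
  -- Cut off outside the upper states above level `i`, the difference solves the homogeneous
  -- equation wherever it is nonzero, because both functions agree at the exits of this region.
  let d : ℕ × ℕ → ℂ := fun x => if i < x.1 ∧ M.c ≤ x.2 then
    M.levelMean α i l x - M.upperSum α (M.cornerMean α i l) x.1 (x.2 + 1 - M.c) else 0
  have hd : ∀ x, ‖d x‖ ≤ 1 / α.re + 1 / α.re := fun x => by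
    simp only [d]
    split_ifs
    · exact (norm_sub_le _ _).trans
        (add_le_add (norm_levelMean_le hα i l x) (norm_upperSum_le hα.le hH _ _))
    · rw [norm_zero]
      positivity
  have h0 : d (a, b) = 0 := by
    refine M.eq_zero_of_gen hα hd (fun x hx => ?_) (a, b)
    obtain ⟨a, b⟩ := x
    have hab : i < a ∧ M.c ≤ b := by
      by_contra h
      exact hx (if_neg h)
    obtain ⟨ha, hb⟩ := hab
    have e1 : d (a, b) = M.levelMean α i l (a, b) -
      M.upperSum α (M.cornerMean α i l) a (b + 1 - M.c) := if_pos ⟨ha, hb⟩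
    have e2 : stateInd (i + 1, l) (a, b) = 0 := if_neg fun h => by
      have := (Prod.mk.inj h).2
      omega
    rw [e1, mul_sub, levelMean_eq h1 hα, upperSum_eq h2 hα hH hb, e2, zero_add, ← gen_sub]
    refine gen_congr ?_ ?_ (fun _ h => absurd hb (not_le.2 h)) fun hb0 => ?_
    · have e3 : ¬ (a + 1, b) ∈ M.lowerLevel i := fun h => by have := h.1; simp at this; omega
      have e4 : i < a + 1 ∧ M.c ≤ b := by omega
      simp [d, e3, e4]
    · have e3 : ¬ (a, b + 1) ∈ M.lowerLevel i := fun h => by have := h.1; simp at this; omega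
      have e4 : i < a ∧ M.c ≤ b + 1 := by omega
      simp [d, e3, e4]
    · have e3 : ¬ (a, b - 1) ∈ M.lowerLevel i := fun h => by have := h.1; simp at this; omega
      rcases hb.lt_or_eq with hlt | heq
      · have e4 : i < a ∧ M.c ≤ b - 1 := by omega
        simp [d, e3, e4]
      -- Here `b = c`: a class-2 departure ends the busy period at `(a, c - 1)`, where `upperSum`
      -- reduces to the corner value, which is `levelMean` itself.
      · have e4 : ¬ (i < a ∧ M.c ≤ b - 1) := by omega
        have e5 : b - 1 + 1 - M.c = 0 := by omega
        simp only [d, e4, e5, if_false]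
        rw [if_neg e3, upperSum, busySum_zero, cornerMean, if_pos ha, heq, sub_self]
  have e1 : d (a, b) = M.levelMean α i l (a, b) -
    M.upperSum α (M.cornerMean α i l) a (b + 1 - M.c) := if_pos ⟨ha, hb⟩
  rw [e1] at h0
  exact sub_eq_zero.1 h0

/-- The strong Markov property at the first transition into lower level `i + 1`. -/
lemma levelMean_eq_sum (h1 : 0 < M.lam₁) (hα : 0 < α.re) (i l : ℕ) {a b : ℕ} (ha : i + 1 < a) :
    M.levelMean α i l (a, b) =
      ∑ p ∈ Finset.range M.c, M.levelMean α i l (i + 1, p) * M.hitMean α (i + 1) p (a, b) := by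
  classical
  set v : ℕ × ℕ → ℂ := fun x =>
    ∑ p ∈ Finset.range M.c, M.levelMean α i l (i + 1, p) * M.hitMean α (i + 1) p x with hv
  let d : ℕ × ℕ → ℂ := fun x => if i + 1 < x.1 then M.levelMean α i l x - v x else 0
  have hd : ∀ x, ‖d x‖ ≤ 1 / α.re + ∑ _p ∈ Finset.range M.c, 1 / α.re * 1 := fun x => by
    simp only [d]
    split_ifs
    · refine (norm_sub_le _ _).trans (add_le_add (norm_levelMean_le hα i l x)
        ((norm_sum_le _ _).trans (Finset.sum_le_sum fun p _ => ?_)))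
      rw [norm_mul]
      gcongr
      · exact norm_levelMean_le hα i l _
      · exact norm_hitMean_le hα _ _ _
    · rw [norm_zero]
      positivity
  have h0 : d (a, b) = 0 := by
    refine M.eq_zero_of_gen hα hd (fun x hx => ?_) (a, b)
    obtain ⟨a, b⟩ := x
    have ha : i + 1 < a := by
      by_contra h
      exact hx (if_neg h)
    have e1 : d (a, b) = M.levelMean α i l (a, b) - v (a, b) := if_pos ha
    have e2 : stateInd (i + 1, l) (a, b) = 0 := if_neg fun h => by
      have := (Prod.mk.inj h).1
      omega
    have e3 : (α + M.exit (a, b)) * v (a, b) = ∑ p ∈ Finset.range M.c,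
        M.levelMean α i l (i + 1, p) * M.gen (fun y => if y ∈ M.lowerLevel (i + 1) then
          stateInd (i + 1, p) y else M.hitMean α (i + 1) p y) (a, b) := by
      simp only [hv, Finset.mul_sum]
      refine Finset.sum_congr rfl fun p _ => ?_
      rw [← hitMean_eq h1 hα]
      ring
    rw [e1, mul_sub, levelMean_eq h1 hα, e2, zero_add, e3, ← gen_sum, ← gen_sub]
    have key : ∀ a' b', i + 1 < a' →
        ((if (a', b') ∈ M.lowerLevel i then 0 else M.levelMean α i l (a', b')) -
          ∑ p ∈ Finset.range M.c, M.levelMean α i l (i + 1, p) *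
            (if (a', b') ∈ M.lowerLevel (i + 1) then stateInd (i + 1, p) (a', b')
              else M.hitMean α (i + 1) p (a', b'))) = d (a', b') := by
      intro a' b' ha'
      have f1 : ¬ (a', b') ∈ M.lowerLevel i := fun h => by have := h.1; simp at this; omega
      have f2 : ¬ (a', b') ∈ M.lowerLevel (i + 1) := fun h => by have := h.1; simp at this; omega
      simp only [f1, f2, if_false, d, ha', if_true, hv]
    refine gen_congr (key _ _ (by omega)) (key _ _ ha) (fun _ hb => ?_) fun _ => key _ _ ha
    -- The only exit from the levels above `i + 1` is a class-1 departure from level `i + 2`. It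
    -- requires `b < c`, so it lands in lower level `i + 1`, where the sum over `p` collapses to the
    -- single term `p = b`.
    rcases (Nat.succ_le_of_lt ha).lt_or_eq with hlt | heq
    · exact key _ _ (by omega)
    · have heq' : a - 1 = i + 1 := by omega
      have f1 : ¬ (i + 1, b) ∈ M.lowerLevel i := fun h => by have := h.1; simp at this
      have f2 : (i + 1, b) ∈ M.lowerLevel (i + 1) := ⟨rfl, hb⟩
      have f3 : ∀ p, stateInd (i + 1, p) (i + 1, b) = if b = p then 1 else 0 := fun p => by
        simp [stateInd]
      simp only [heq', f1, f2, if_false, if_true, d, f3, mul_ite, mul_one, mul_zero,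
        lt_irrefl, Finset.sum_ite_eq, Finset.mem_range, hb, sub_self]
  have e1 : d (a, b) = M.levelMean α i l (a, b) - v (a, b) := if_pos ha
  rw [e1] at h0
  exact sub_eq_zero.1 h0

/-! ### Last exit from the lower levels at most `i`. -/

/-- The discounted mean time in `(i + 1, l)` before the first visit to a lower level `≤ i`. -/
def excMean (M : Params) (α : ℂ) (i l : ℕ) (x : ℕ × ℕ) : ℂ :=
  if x.2 < M.c then if i < x.1 then M.levelMean α i l x else 0
  else M.upperSum α (M.cornerMean α i l) x.1 (x.2 + 1 - M.c)

lemma norm_excMean_le (hα : 0 < α.re) (i l : ℕ) (x : ℕ × ℕ) :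
    ‖M.excMean α i l x‖ ≤ 1 / α.re := by
  rw [excMean]
  split_ifs
  · exact norm_levelMean_le hα i l _
  · rw [norm_zero]
    positivity
  · exact norm_upperSum_le hα.le (norm_cornerMean_le hα i l) _ _

lemma excMean_of_le {i l a b : ℕ} (ha : a ≤ i) (hb : b < M.c) : M.excMean α i l (a, b) = 0 := by
  rw [excMean, if_pos hb, if_neg (not_lt.2 ha)]

/-- From above level `i`, lower level `i` is the first of the lower levels at most `i` to be
entered. Only the upper states need an argument, namely the excursion identity. -/
lemma excMean_of_lt (hc : 0 < M.c) (h1 : 0 < M.lam₁) (h2 : 0 < M.lam₂) (hα : 0 < α.re)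
    {i l : ℕ} (hl : l < M.c) {a b : ℕ} (ha : i < a) :
    M.excMean α i l (a, b) = M.levelMean α i l (a, b) := by
  by_cases hb : b < M.c
  · rw [excMean, if_pos hb, if_pos ha]
  · rw [excMean, if_neg hb, levelMean_eq_upperSum hc h1 h2 hα hl ha (not_lt.1 hb)]

/-- Above level `i` this is the equation of `levelMean`, whose killing in lower level `i` matches
the value 0 of `excMean` there. At upper states of levels at most `i` it is the equation of
`upperSum`. -/
lemma excMean_eq (hc : 0 < M.c) (h1 : 0 < M.lam₁) (h2 : 0 < M.lam₂) (hα : 0 < α.re)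
    {i l : ℕ} (hl : l < M.c) {a b : ℕ} (hab : ¬ (a ≤ i ∧ b < M.c)) :
    (α + M.exit (a, b)) * M.excMean α i l (a, b) =
      stateInd (i + 1, l) (a, b) + M.gen (M.excMean α i l) (a, b) := by
  classical
  by_cases ha : i < a
  · rw [excMean_of_lt hc h1 h2 hα hl ha, levelMean_eq h1 hα]
    congr 1
    have key : ∀ a' b', i < a' → (if (a', b') ∈ M.lowerLevel i then 0
        else M.levelMean α i l (a', b')) = M.excMean α i l (a', b') := fun a' b' ha' => by
      have f1 : ¬ (a', b') ∈ M.lowerLevel i := fun h => by have := h.1; simp at this; omega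
      rw [if_neg f1, excMean_of_lt hc h1 h2 hα hl ha']
    refine gen_congr (key _ _ (by omega)) (key _ _ ha) (fun _ hb => ?_) fun _ => key _ _ ha
    rcases (Nat.succ_le_of_lt ha).lt_or_eq with hlt | heq
    · exact key _ _ (by omega)
    · have heq' : a - 1 = i := by omega
      have f2 : (i, b) ∈ M.lowerLevel i := ⟨rfl, hb⟩
      simp only [heq']
      rw [if_pos f2, excMean_of_le le_rfl hb]
  · have hb : M.c ≤ b := by omega
    have e1 : stateInd (i + 1, l) (a, b) = 0 := if_neg fun h => by
      have := (Prod.mk.inj h).2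
      omega
    have key : ∀ a' b', M.c ≤ b' → M.upperSum α (M.cornerMean α i l) a' (b' + 1 - M.c) =
        M.excMean α i l (a', b') := fun a' b' hb' => (if_neg (not_lt.2 hb')).symm
    rw [← key _ _ hb, upperSum_eq h2 hα (norm_cornerMean_le hα i l) hb, e1, zero_add]
    refine gen_congr (key _ _ hb) (key _ _ (by omega)) (fun _ h => absurd hb (not_le.2 h))
      fun _ => ?_
    rcases hb.lt_or_eq with hlt | heq
    · exact key _ _ (by omega)
    · have e2 : b - 1 + 1 - M.c = 0 := by omega
      have e3 : b - 1 < M.c := by omega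
      simp only [e2]
      rw [upperSum, busySum_zero, excMean, if_pos e3, cornerMean, heq]

/-- The decomposition at the last exit from the lower levels `≤ i`. -/
lemma resolvent_eq_sum (hc : 0 < M.c) (h1 : 0 < M.lam₁) (h2 : 0 < M.lam₂) (hα : 0 < α.re)
    {i l : ℕ} (hl : l < M.c) : M.resolvent α (i + 1, l) (0, 0) =
      ∑ y ∈ Finset.range (i + 1) ×ˢ Finset.range M.c,
        M.gen (M.excMean α i l) y * M.resolvent α y (0, 0) := by
  set B := Finset.range (i + 1) ×ˢ Finset.range M.c with hB
  -- The sum of resolvents compensates the defect of `excMean` on `B`, so `e` is a bounded solution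
  -- of the homogeneous equation on the whole state space.
  let e : ℕ × ℕ → ℂ := fun x => (M.excMean α i l x - M.resolvent α (i + 1, l) x) +
    ∑ y ∈ B, M.gen (M.excMean α i l) y * M.resolvent α y x
  have he : ∀ x, ‖e x‖ ≤ (1 / α.re + 1 / α.re) +
      ∑ y ∈ B, ‖M.gen (M.excMean α i l) y‖ * (1 / α.re) := fun x => by
    refine (norm_add_le _ _).trans (add_le_add ((norm_sub_le _ _).trans (add_le_add
      (norm_excMean_le hα i l x) (norm_resolvent_le hα _ x)))
      ((norm_sum_le _ _).trans (Finset.sum_le_sum fun y _ => ?_)))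
    rw [norm_mul]
    gcongr
    exact norm_resolvent_le hα _ _
  have h0 : e (0, 0) = 0 := by
    refine M.eq_zero_of_gen hα he (fun x _ => ?_) (0, 0)
    have e1 : (α + M.exit x) * ∑ y ∈ B, M.gen (M.excMean α i l) y * M.resolvent α y x =
        (if x ∈ B then M.gen (M.excMean α i l) x else 0) +
          M.gen (fun z => ∑ y ∈ B, M.gen (M.excMean α i l) y * M.resolvent α y z) x := by
      rw [gen_sum, Finset.mul_sum, ← Finset.sum_ite_eq B x, ← Finset.sum_add_distrib]
      refine Finset.sum_congr rfl fun y _ => ?_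
      have := resolvent_eq h1 hα y x
      by_cases hxy : x = y
      · subst hxy
        rw [stateInd, if_pos rfl] at this
        rw [if_pos rfl]
        linear_combination M.gen (M.excMean α i l) x * this
      · rw [stateInd, if_neg hxy] at this
        rw [if_neg hxy]
        linear_combination M.gen (M.excMean α i l) y * this
    have e2 : M.gen e x = M.gen (M.excMean α i l) x - M.gen (M.resolvent α (i + 1, l)) x +
        M.gen (fun z => ∑ y ∈ B, M.gen (M.excMean α i l) y * M.resolvent α y z) x := by
      rw [← gen_sub, ← gen_add]
    have e3 := resolvent_eq h1 hα (i + 1, l) x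
    simp only [e]
    rw [mul_add, mul_sub, e1, e3, e2]
    obtain ⟨a, b⟩ := x
    -- On `B` both `excMean` and the source vanish, so the missing term is `gen` of `excMean`; it is
    -- supplied by the summand `y = x`.
    by_cases hx : (a, b) ∈ B
    · have hx' : a ≤ i ∧ b < M.c := by
        simp only [hB, Finset.mem_product, Finset.mem_range] at hx
        omega
      have e4 : stateInd (i + 1, l) (a, b) = 0 := if_neg fun h => by
        have := (Prod.mk.inj h).1
        omega
      rw [if_pos hx, excMean_of_le hx'.1 hx'.2, e4]
      ring
    · have hx' : ¬ (a ≤ i ∧ b < M.c) := fun h => hx (by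
        simp only [hB, Finset.mem_product, Finset.mem_range]
        omega)
      rw [if_neg hx, excMean_eq hc h1 h2 hα hl hx']
      ring
  simp only [e] at h0
  -- The starting state `(0, 0)` lies in `B` because `c > 0`.
  rw [excMean_of_le i.zero_le hc] at h0
  linear_combination -h0

/-- Departures from `B` stay in `B`, where `excMean` vanishes. The surviving jumps are class-1
arrivals at level `i` and class-2 arrivals at `(k, c - 1)`: the two kinds of terms in the recursion.
-/
lemma gen_excMean (hc : 0 < M.c) (h1 : 0 < M.lam₁) (h2 : 0 < M.lam₂) (hα : 0 < α.re)
    {i l : ℕ} (hl : l < M.c) {k j : ℕ} (hk : k ≤ i) (hj : j < M.c) :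
    M.gen (M.excMean α i l) (k, j) =
      (if k = i then M.lam₁ * M.levelMean α i l (i + 1, j) else 0) +
        if j + 1 = M.c then M.lam₂ * M.upperSum α (M.cornerMean α i l) k 1 else 0 := by
  have e1 : M.excMean α i l (k - 1, j) = 0 := excMean_of_le (by omega) hj
  have e2 : M.excMean α i l (k, j - 1) = 0 := excMean_of_le hk (by omega)
  have e3 : (M.lam₁ : ℂ) * M.excMean α i l (k + 1, j) =
      if k = i then M.lam₁ * M.levelMean α i l (i + 1, j) else 0 := by
    split_ifs with h
    · rw [h, excMean_of_lt hc h1 h2 hα hl (Nat.lt_succ_self i)]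
    · rw [excMean_of_le (by omega) hj, mul_zero]
  have e4 : (M.lam₂ : ℂ) * M.excMean α i l (k, j + 1) =
      if j + 1 = M.c then M.lam₂ * M.upperSum α (M.cornerMean α i l) k 1 else 0 := by
    split_ifs with h
    · rw [excMean, if_neg (by simp [h]), h, Nat.add_sub_cancel_left]
    · rw [excMean_of_le hk (by omega), mul_zero]
  rw [gen_eq, e1, e2, mul_zero, mul_zero, add_zero, add_zero, e3, e4]

/-! ### Translation into matrices. -/

lemma N_apply (h1 : 0 < M.lam₁) (i : ℕ) (α : ℂ) (k l : Fin M.c) :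
    M.N (i + 1) α k l = M.levelMean α i l (i + 1, k) :=
  M.N_eq h1 (i + 1) α k l

/-- The path to lower level `i` passes through lower level `i + 1`; for `a = i + 1` the convention
that `G` is the identity takes over. -/
lemma G_mul_N_apply (h1 : 0 < M.lam₁) (hα : 0 < α.re) {i a : ℕ} (ha : i < a) (k l : Fin M.c) :
    (M.G a (i + 1) α * M.N (i + 1) α) k l = M.levelMean α i l (a, k) := by
  rcases (Nat.succ_le_of_lt ha).eq_or_lt with rfl | hlt
  · have hG : M.G (i + 1) (i + 1) α = 1 := if_pos rfl
    rw [Nat.succ_eq_add_one, hG, Matrix.one_mul, N_apply h1]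
  · rw [Matrix.mul_apply, levelMean_eq_sum h1 hα i l hlt, Finset.sum_range]
    refine Finset.sum_congr rfl fun p _ => ?_
    rw [N_apply h1, M.G_eq h1 hlt.ne' α k p, mul_comm]
    rfl

lemma W_mul_G_mul_N_apply (h1 : 0 < M.lam₁) (h2 : 0 < M.lam₂) (hα : 0 < α.re) {i a : ℕ}
    (ha : i < a) (m : ℕ) (k l : Fin M.c) :
    (M.W m α * M.G a (i + 1) α * M.N (i + 1) α) k l = if (k : ℕ) + 1 = M.c then
      M.lam₂ * (busyCoef M.lam₂ (M.c * M.mu₂) M.lam₁ α 1 m * M.levelMean α i l (a, M.c - 1))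
        else 0 := by
  rw [Matrix.mul_assoc, Matrix.mul_apply]
  split_ifs with hk
  · have hk' : M.c - 1 = k := by omega
    rw [Finset.sum_eq_single k]
    · rw [W, if_pos ⟨hk, hk⟩, G_mul_N_apply h1 hα ha, busyPoisson_eq h2 _ h1 hα.le, hk', mul_assoc]
    · intro p _ hp
      rw [W, if_neg, zero_mul]
      rintro ⟨-, hp'⟩
      exact hp (Fin.ext (by omega))
    · exact fun h => absurd (Finset.mem_univ k) h
  · refine Finset.sum_eq_zero fun p _ => ?_
    rw [W, if_neg fun h => hk h.1, zero_mul]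

/-- The sum over the level at the end of an upper excursion from level `k`. -/
lemma hasSum_busyCoef_levelMean (hα : 0 < α.re) (i l : ℕ) {k : ℕ} (hk : k ≤ i) :
    HasSum (fun a : Set.Ici (i + 1) =>
      busyCoef M.lam₂ (M.c * M.mu₂) M.lam₁ α 1 ((a : ℕ) - k) * M.levelMean α i l (a, M.c - 1))
      (M.upperSum α (M.cornerMean α i l) k 1) := by
  have hs := (summable_busySum M.lam₂ (M.c * M.mu₂) M.lam₁ hα.le
    (norm_cornerMean_le (M := M) hα i l) k 1).hasSum
  have hinj : Function.Injective fun a : Set.Ici (i + 1) => (a : ℕ) - k := by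
    rintro ⟨a, ha⟩ ⟨b, hb⟩ hab
    simp only [Set.mem_Ici] at ha hb
    simp only at hab
    exact Subtype.ext (by simp only; omega)
  -- The indices `m` not of the form `a - k` with `a > i` satisfy `k + m ≤ i`: the excursion returns
  -- inside `B`, and the corner value is 0.
  have hr : ∀ m ∉ Set.range (fun a : Set.Ici (i + 1) => (a : ℕ) - k),
      busyCoef M.lam₂ (M.c * M.mu₂) M.lam₁ α 1 m * M.cornerMean α i l (k + m) = 0 := by
    intro m hm
    rw [cornerMean, if_neg, mul_zero]
    intro him
    exact hm ⟨⟨k + m, Nat.succ_le_of_lt him⟩, by simp⟩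
  have hcomp : (fun a : Set.Ici (i + 1) => busyCoef M.lam₂ (M.c * M.mu₂) M.lam₁ α 1 ((a : ℕ) - k) *
      M.levelMean α i l (a, M.c - 1)) =
      (fun m => busyCoef M.lam₂ (M.c * M.mu₂) M.lam₁ α 1 m * M.cornerMean α i l (k + m)) ∘
        fun a : Set.Ici (i + 1) => (a : ℕ) - k := by
    funext a
    have ha : i + 1 ≤ (a : ℕ) := a.2
    have hka : k + ((a : ℕ) - k) = a := by omega
    rw [Function.comp_apply, hka, cornerMean, if_pos (Nat.lt_of_succ_le ha)]
  rw [hcomp]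
  exact (hinj.hasSum_iff hr).2 hs

/-- The matrix series in closed form. -/
lemma hasSum_W_mul_G_mul_N (h1 : 0 < M.lam₁) (h2 : 0 < M.lam₂) (hα : 0 < α.re) {i k : ℕ}
    (hk : k ≤ i) :
    HasSum (fun a : Set.Ici (i + 1) => M.W ((a : ℕ) - k) α * M.G a (i + 1) α * M.N (i + 1) α)
      (Matrix.of fun r l : Fin M.c => if (r : ℕ) + 1 = M.c then
        (M.lam₂ : ℂ) * M.upperSum α (M.cornerMean α i l) k 1 else 0) := by
  refine Pi.hasSum.2 fun r => Pi.hasSum.2 fun l => ?_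
  have h : ∀ a : Set.Ici (i + 1), (M.W ((a : ℕ) - k) α * M.G a (i + 1) α * M.N (i + 1) α) r l =
      if (r : ℕ) + 1 = M.c then (M.lam₂ : ℂ) * (busyCoef M.lam₂ (M.c * M.mu₂) M.lam₁ α 1
        ((a : ℕ) - k) * M.levelMean α i l (a, M.c - 1)) else 0 := fun a =>
    W_mul_G_mul_N_apply h1 h2 hα a.2 _ r l
  simp only [h, Matrix.of_apply]
  split_ifs
  · exact (hasSum_busyCoef_levelMean hα i l hk).mul_left _
  · exact hasSum_zero

/-- The recursion for the Laplace transforms of the transition functions of the lower levels. -/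
theorem piVec_succ (hc : 0 < M.c) (hlam₁ : 0 < M.lam₁) (hlam₂ : 0 < M.lam₂) (hα : 0 < α.re)
    (i : ℕ) :
    M.piVec (i + 1) α = M.piVec i α ᵥ* (M.A₁ * M.N (i + 1) α) +
      ∑ k ∈ Finset.range (i + 1), M.piVec k α ᵥ*
        ∑' l : Set.Ici (i + 1), M.W ((l : ℕ) - k) α * M.G l (i + 1) α * M.N (i + 1) α := by
  funext l
  have hπ : ∀ y, M.resolvent α y (0, 0) = M.laplace y α := fun y => (M.laplace_eq hα y).symm
  have h := resolvent_eq_sum (α := α) (i := i) hc hlam₁ hlam₂ hα l.2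
  simp only [hπ] at h
  rw [Finset.sum_product] at h
  -- The sum over `B` is grouped by levels. The part present only for `k = i` becomes the `A₁ N`
  -- term, and the other part becomes the series for level `k`.
  have h2 : ∀ k ∈ Finset.range (i + 1), ∑ j ∈ Finset.range M.c,
      M.gen (M.excMean α i l) (k, j) * M.laplace (k, j) α =
        (if k = i then ∑ j : Fin M.c, M.laplace (k, j) α *
          ((M.lam₁ : ℂ) * M.levelMean α i l (i + 1, j)) else 0) +
        ∑ j : Fin M.c, M.laplace (k, j) α * if (j : ℕ) + 1 = M.c then
          (M.lam₂ : ℂ) * M.upperSum α (M.cornerMean α i l) k 1 else 0 := by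
    intro k hk
    rw [Finset.sum_range]
    have hk' : k ≤ i := Nat.lt_succ_iff.1 (Finset.mem_range.1 hk)
    simp only [fun j : Fin M.c => gen_excMean hc hlam₁ hlam₂ hα l.2 hk' j.2]
    split_ifs with hki
    · rw [← Finset.sum_add_distrib]
      exact Finset.sum_congr rfl fun j _ => by ring
    · rw [zero_add]
      exact Finset.sum_congr rfl fun j _ => by ring
  rw [Finset.sum_congr rfl h2, Finset.sum_add_distrib, Finset.sum_ite_eq',
    if_pos (Finset.self_mem_range_succ i)] at h
  rw [Pi.add_apply, Finset.sum_apply]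
  refine h.trans (congrArg₂ _ ?_ ?_)
  · simp only [Matrix.vecMul, dotProduct, piVec, A₁, Matrix.smul_mul, Matrix.one_mul,
      Matrix.smul_apply, smul_eq_mul, N_apply hlam₁]
  · refine Finset.sum_congr rfl fun k hk => ?_
    rw [(hasSum_W_mul_G_mul_N hlam₁ hlam₂ hα (Nat.lt_succ_iff.1 (Finset.mem_range.1 hk))).tsum_eq]
    rfl

end Params

end PriorityQueue

end

/-- Summability is unconditional, which in a finite-dimensional space of matrices is the same as
absolute convergence. -/
theorem theorem4 (M : PriorityQueue.Params) (hc : 0 < M.c)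
    (hlam₁ : 0 < M.lam₁) (hlam₂ : 0 < M.lam₂) (hmu₁ : 0 < M.mu₁) (hmu₂ : 0 < M.mu₂)
    (α : ℂ) (hα : 0 < α.re) (i : ℕ) :
    (∀ k ≤ i, Summable fun l : Set.Ici (i + 1) =>
      M.W ((l : ℕ) - k) α * M.G l (i + 1) α * M.N (i + 1) α) ∧
    M.piVec (i + 1) α = M.piVec i α ᵥ* (M.A₁ * M.N (i + 1) α) +
      ∑ k ∈ Finset.range (i + 1), M.piVec k α ᵥ*
        ∑' l : Set.Ici (i + 1), M.W ((l : ℕ) - k) α * M.G l (i + 1) α * M.N (i + 1) α :=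
  ⟨fun _ hk => (PriorityQueue.Params.hasSum_W_mul_G_mul_N hlam₁ hlam₂ hα hk).summable,
    PriorityQueue.Params.piVec_succ hc hlam₁ hlam₂ hα i⟩
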